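/- Let $c>0$, $\chi>0$. A real random variable $X$ is called modified-Weibull $\mathcal W(c,\chi)$ if $\operatorname{sgn}(X)\,\sqrt2\,(|X|/\chi)^{c/2}$ has the standard normal law. Two real random variables $X,Y$ with distribution functions $F,G$ are equivalent in the upper tail if $\lim_{x\to+\infty}\frac{1-F(x)}{1-G(x)}$ exists in $(0,\infty)$, and equivalent in the lower tail if $\lim_{x\to-\infty}\frac{F(x)}{G(x)}$ exists in $(0,\infty)$. Let $X_1,\dots,X_N$ be independent $\mathcal W(c,\chi)$ random variables, let $w_1,\dots,w_N$ be real numbers, not all zero, and let $S=\sum_{i=1}^N w_iX_i$. (a) If $c>1$, then $S$ is equivalent in the upper and in the lower tail to $Z\sim\mathcal W(c,\hat\chi)$ with $$\hat\chi=\Big(\sum_{i=1}^N|w_i|^{\frac{c}{c-1}}\Big)^{\frac{c-1}{c}}\chi ,$$ and both limits of tail ratios (of $S$ to $Z$) are equal to $\big[\frac{c}{2(c-1)}\big]^{(n-1)/2}$, where $n$ is the number of indices $i$ with $w_i\neq0$ (so $n=N$ if no weight vanishes). (b) If $c<1$, or if $c=1$ and $\max_j|w_j|$ is attained at exactly one index,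 then $S$ is equivalent in the upper and in the lower tail to $Z\sim\mathcal W(c,\hat\chi)$ with $\hat\chi=\max_i|w_i|\cdot\chi$. If $c<1$, both limits of tail ratios are equal to the number of indices $i$ with $|w_i|=\max_j|w_j|$. -/

import Mathlib

open MeasureTheory ProbabilityTheory Filter Topology

/-- `X` is modified-Weibull `W(c, χ)` under `μ`: `X` is a random variable and
`Y = sgn(X) √2 (|X| / χ)^(c/2)` has the standard normal law. -/
def IsModifiedWeibull {Ω : Type*} [MeasurableSpace Ω] (X : Ω → ℝ) (c χ : ℝ)
    (μ : Measure Ω) : Prop :=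
  AEMeasurable X μ ∧
    HasLaw (fun ω => Real.sign (X ω) * √2 * (|X ω| / χ) ^ (c / 2)) (gaussianReal 0 1) μ

/-- With `F`, `G` the distribution functions of `X` and `Y`,
`(1 - F x) / (1 - G x) → l` as `x → +∞`. -/
def UpperTailRatio {Ω Ω' : Type*} [MeasurableSpace Ω] [MeasurableSpace Ω']
    (X : Ω → ℝ) (μ : Measure Ω) (Y : Ω' → ℝ) (ν : Measure Ω') (l : ℝ) : Prop :=
  Tendsto (fun x : ℝ => (1 - cdf (μ.map X) x) / (1 - cdf (ν.map Y) x)) atTop (𝓝 l)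

/-- With `F`, `G` the distribution functions of `X` and `Y`,
`F x / G x → l` as `x → -∞`. -/
def LowerTailRatio {Ω Ω' : Type*} [MeasurableSpace Ω] [MeasurableSpace Ω']
    (X : Ω → ℝ) (μ : Measure Ω) (Y : Ω' → ℝ) (ν : Measure Ω') (l : ℝ) : Prop :=
  Tendsto (fun x : ℝ => cdf (μ.map X) x / cdf (ν.map Y) x) atBot (𝓝 l)

/-- `X` and `Y` are equivalent in the upper tail. -/
def UpperTailEquiv {Ω Ω' : Type*} [MeasurableSpace Ω] [MeasurableSpace Ω']
    (X : Ω → ℝ) (μ : Measure Ω) (Y : Ω' → ℝ) (ν : Measure Ω') : Prop :=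
  ∃ l : ℝ, 0 < l ∧ UpperTailRatio X μ Y ν l

/-- `X` and `Y` are equivalent in the lower tail. -/
def LowerTailEquiv {Ω Ω' : Type*} [MeasurableSpace Ω] [MeasurableSpace Ω']
    (X : Ω → ℝ) (μ : Measure Ω) (Y : Ω' → ℝ) (ν : Measure Ω') : Prop :=
  ∃ l : ℝ, 0 < l ∧ LowerTailRatio X μ Y ν l

/-! A modified Weibull variable of scale `χ` is `χ sgn(V) |V| ^ (2 / c)` with `V` centred Gaussian
of variance `1 / 2`, so Mills' ratio (`tendsto_gaussianReal_half_Ioi`) gives its tail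
`(x / χ) ^ (-c / 2) exp (-(x / χ) ^ c) / (2 √π)`. The predicate `HasTail` records tails of this
form up to a constant, and the summands are added one at a time.

For `c > 1` this is Laplace's method (`HasTail.add_weibull`): both summands must be of the order of
the level `x`. In the Gaussian coordinate `v` of the new summand the exponent is
`x ^ c Φ(v / x ^ (c / 2))`, where `Φ` has a unique minimum, is quadratic there
(`tendsto_phase_div_sq`) and is bounded below by a quadratic function on the whole line
(`exists_mul_sq_le_phase`). The optimal split gives the `ℓ^(c / (c - 1))` combination of the scales,
and the Gaussian integral the factor `√(c / (2 (c - 1)))`. Using `v` rather than the value of the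
summand avoids the singularity of the Weibull density at `0`, and the width of the peak does not
depend on the level.

For `c < 1` a single summand is large (`HasTail.conv`): the tail `exp (-x ^ c)` is insensitive to
bounded shifts, two large summands cost too much because `2 (x / 2) ^ c > x ^ c`, and the constants
of the summands of maximal scale add up. For `c = 1` the unique summand of maximal scale is large
and the others multiply its tail by an exponential moment (`HasTail.add_light`). In both cases the
dominated convergence rests on exponential moments of the sums (`integrable_exp_sum`).

Lower tails are the upper tails of the sum with opposite weights; the boundary point of the closed
half-line is harmless by `HasTail.real_Ici`. -/

/-! ### Gaussian coordinates -/

/-- The odd extension `v ↦ sgn(v) |v| ^ r` of the power function. Writing it through positive and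
negative parts makes continuity evident. -/
noncomputable def oddPow (r v : ℝ) : ℝ := (max v 0) ^ r - (max (-v) 0) ^ r

lemma oddPow_of_nonneg {r v : ℝ} (hr : 0 < r) (hv : 0 ≤ v) : oddPow r v = v ^ r := by
  rw [oddPow, max_eq_left hv, max_eq_right (by linarith), Real.zero_rpow hr.ne', sub_zero]

lemma oddPow_neg (r v : ℝ) : oddPow r (-v) = -oddPow r v := by
  simp [oddPow]

lemma oddPow_of_nonpos {r v : ℝ} (hr : 0 < r) (hv : v ≤ 0) : oddPow r v = -(-v) ^ r := by
  rw [← oddPow_of_nonneg hr (neg_nonneg.2 hv), oddPow_neg, neg_neg]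

lemma abs_oddPow {r : ℝ} (hr : 0 < r) (v : ℝ) : |oddPow r v| = |v| ^ r := by
  rcases le_total 0 v with hv | hv
  · rw [oddPow_of_nonneg hr hv, abs_of_nonneg (Real.rpow_nonneg hv r), abs_of_nonneg hv]
  · rw [oddPow_of_nonpos hr hv, abs_neg, abs_of_nonneg (Real.rpow_nonneg (by linarith) r),
      abs_of_nonpos hv]

lemma continuous_oddPow {r : ℝ} (hr : 0 < r) : Continuous (oddPow r) := by
  unfold oddPow
  exact ((continuous_id.max continuous_const).rpow_const fun _ => Or.inr hr.le).sub
    ((continuous_neg.max continuous_const).rpow_const fun _ => Or.inr hr.le)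

lemma oddPow_mul {r R : ℝ} (hr : 0 < r) (hR : 0 ≤ R) (s : ℝ) :
    oddPow r (R * s) = R ^ r * oddPow r s := by
  rcases le_total 0 s with hs | hs
  · rw [oddPow_of_nonneg hr hs, oddPow_of_nonneg hr (by positivity), Real.mul_rpow hR hs]
  · rw [oddPow_of_nonpos hr hs, oddPow_of_nonpos hr (mul_nonpos_of_nonneg_of_nonpos hR hs),
      ← mul_neg, Real.mul_rpow hR (by linarith)]
    ring

/-- The law of `β · sgn(V) |V| ^ (2 / c)` for a centred Gaussian `V` of variance `1 / 2`, whose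
density is `exp (-v²) / √π`. With this variance no factor `√2` is left. -/
noncomputable def weibullLaw (c β : ℝ) : Measure ℝ :=
  (gaussianReal 0 (1 / 2)).map fun v => β * oddPow (2 / c) v

lemma measurable_weibullMap {c : ℝ} (hc : 0 < c) (β : ℝ) :
    Measurable fun v => β * oddPow (2 / c) v :=
  ((continuous_oddPow (by positivity)).measurable).const_mul β

lemma isProbabilityMeasure_weibullLaw {c : ℝ} (hc : 0 < c) (β : ℝ) :
    IsProbabilityMeasure (weibullLaw c β) :=
  Measure.isProbabilityMeasure_map (measurable_weibullMap hc β).aemeasurable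

lemma weibullLaw_neg {c : ℝ} (hc : 0 < c) (β : ℝ) : weibullLaw c (-β) = weibullLaw c β := by
  have h : (gaussianReal 0 (1 / 2)).map (fun v : ℝ => -v) = gaussianReal 0 (1 / 2) := by
    rw [gaussianReal_map_neg, neg_zero]
  unfold weibullLaw
  conv_rhs => rw [← h, Measure.map_map (measurable_weibullMap hc β) measurable_neg]
  congr 1
  ext v
  simp [oddPow_neg]

lemma weibullLaw_abs {c : ℝ} (hc : 0 < c) (β : ℝ) : weibullLaw c |β| = weibullLaw c β := by
  rcases abs_choice β with h | h <;> rw [h]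
  exact weibullLaw_neg hc β

/-- Inverting the defining Gaussian transform pointwise. -/
lemma eq_mul_oddPow {c χ : ℝ} (hc : 0 < c) (hχ : 0 < χ) (x : ℝ) :
    x = χ * oddPow (2 / c) ((√2)⁻¹ * (Real.sign x * √2 * (|x| / χ) ^ (c / 2))) := by
  have h2 : (√2 : ℝ) ≠ 0 := by positivity
  have hr : 0 < 2 / c := by positivity
  have h3 : (√2)⁻¹ * (Real.sign x * √2 * (|x| / χ) ^ (c / 2)) =
      Real.sign x * (|x| / χ) ^ (c / 2) := by field_simp
  have h4 : ((|x| / χ) ^ (c / 2)) ^ (2 / c) = |x| / χ := by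
    rw [← Real.rpow_mul (by positivity)]
    have : c / 2 * (2 / c) = 1 := by field_simp
    rw [this, Real.rpow_one]
  rw [h3]
  rcases lt_trichotomy x 0 with h | h | h
  · rw [Real.sign_of_neg h, neg_one_mul, oddPow_neg, oddPow_of_nonneg hr (by positivity), h4,
      abs_of_neg h]
    field_simp
  · subst h
    simp [oddPow]
  · rw [Real.sign_of_pos h, one_mul, oddPow_of_nonneg hr (by positivity), h4, abs_of_pos h]
    field_simp

lemma IsModifiedWeibull.map_mul {Ω : Type*} [MeasurableSpace Ω] {X : Ω → ℝ} {c χ : ℝ}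
    {μ : Measure Ω} (h : IsModifiedWeibull X c χ μ) (hc : 0 < c) (hχ : 0 < χ) (w : ℝ) :
    μ.map (fun ω => w * X ω) = weibullLaw c (|w| * χ) := by
  obtain ⟨-, hY⟩ := h
  have hG : (gaussianReal 0 1).map (fun y : ℝ => (√2)⁻¹ * y) = gaussianReal 0 (1 / 2) := by
    rw [gaussianReal_map_const_mul, mul_zero]
    congr 1
    ext
    simp
  have hm1 : Measurable fun y : ℝ => (√2)⁻¹ * y := by fun_prop
  have hm2 := measurable_weibullMap hc (w * χ)
  have e : (fun ω => w * X ω) = ((fun v => w * χ * oddPow (2 / c) v) ∘ fun y : ℝ => (√2)⁻¹ * y) ∘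
      fun ω => Real.sign (X ω) * √2 * (|X ω| / χ) ^ (c / 2) := by
    ext ω
    simp only [Function.comp]
    rw [mul_assoc w χ, ← eq_mul_oddPow hc hχ]
  rw [← abs_of_pos hχ, ← abs_mul, weibullLaw_abs hc, e,
    ← AEMeasurable.map_map_of_aemeasurable (hm2.comp hm1).aemeasurable hY.aemeasurable, hY.map_eq,
    ← Measure.map_map hm2 hm1, hG]
  rfl

lemma integral_gaussianReal_half (f : ℝ → ℝ) :
    ∫ v, f v ∂gaussianReal 0 (1 / 2) = (√Real.pi)⁻¹ * ∫ v, Real.exp (-v ^ 2) * f v := by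
  rw [integral_gaussianReal_eq_integral_smul (by norm_num), ← integral_const_mul]
  congr 1
  ext v
  have h : 2 * Real.pi * ((1 / 2 : NNReal) : ℝ) = Real.pi := by push_cast; ring
  have h' : 2 * ((1 / 2 : NNReal) : ℝ) = 1 := by push_cast; ring
  rw [gaussianPDFReal, h, h', sub_zero, div_one, smul_eq_mul, mul_assoc]

lemma real_conv_Ioi (P Q : Measure ℝ) [IsProbabilityMeasure P] [IsProbabilityMeasure Q] (x : ℝ) :
    (P ∗ Q).real (Set.Ioi x) = ∫ y, P.real (Set.Ioi (x - y)) ∂Q := by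
  have h : (P ∗ Q).real (Set.Ioi x) = ∫ z, (Set.Ioi x).indicator 1 z ∂(P ∗ Q) := by
    rw [integral_indicator_one measurableSet_Ioi]
  rw [Measure.conv_comm] at h ⊢
  rw [h, integral_conv ((integrable_const 1).indicator measurableSet_Ioi)]
  congr 1
  ext y
  rw [← integral_indicator_one measurableSet_Ioi]
  congr 1
  ext z
  simp only [Set.indicator, Set.mem_Ioi, sub_lt_iff_lt_add', Pi.one_apply]

lemma antitone_real_Ioi (P : Measure ℝ) [IsProbabilityMeasure P] :
    Antitone fun x => P.real (Set.Ioi x) :=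
  fun _ _ h => measureReal_mono (Set.Ioi_subset_Ioi h)

/-! ### Weibull tails -/

/-- `T x ∼ a (x / α) ^ (-c / 2) exp (-(x / α) ^ c)` as `x → +∞`: the tail behaviour, up to the
constant `a`, of a modified Weibull law of scale `α`. -/
def HasTail (T : ℝ → ℝ) (c α a : ℝ) : Prop :=
  Tendsto (fun x => T x * ((x / α) ^ (c / 2) * Real.exp ((x / α) ^ c))) atTop (𝓝 a)

/-- Mills' ratio. The substitution `v = r + u / r` turns it into the integral of
`exp (-2 u - (u / r) ^ 2)` over `u > 0`. -/
lemma tendsto_gaussianReal_half_Ioi :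
    Tendsto (fun r : ℝ => (gaussianReal 0 (1 / 2)).real (Set.Ioi r) * (r * Real.exp (r ^ 2))) atTop
      (𝓝 ((√Real.pi)⁻¹ * 2⁻¹)) := by
  have key : ∀ r : ℝ, 0 < r → (gaussianReal 0 (1 / 2)).real (Set.Ioi r) * (r * Real.exp (r ^ 2)) =
      (√Real.pi)⁻¹ *
        ∫ u, (Set.Ioi (0 : ℝ)).indicator (fun u => Real.exp (-2 * u - (u / r) ^ 2)) u := by
    intro r hr
    set h : ℝ → ℝ := fun v => Real.exp (-v ^ 2) * (Set.Ioi r).indicator 1 v with hh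
    have h1 : (gaussianReal 0 (1 / 2)).real (Set.Ioi r) = (√Real.pi)⁻¹ * ∫ v, h v := by
      rw [← integral_indicator_one measurableSet_Ioi, integral_gaussianReal_half]
    have h2 : ∫ u, h (r + u / r) = r * ∫ v, h v := by
      rw [Measure.integral_comp_div (fun w => h (r + w)), integral_add_left_eq_self h r,
        abs_of_pos hr, smul_eq_mul]
    have h3 : ∫ u, (Set.Ioi (0 : ℝ)).indicator (fun u => Real.exp (-2 * u - (u / r) ^ 2)) u =
        ∫ u, Real.exp (r ^ 2) * h (r + u / r) := by
      congr 1
      ext u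
      by_cases hu : 0 < u
      · have : r < r + u / r := by
          have : 0 < u / r := by positivity
          linarith
        simp only [hh, Set.indicator, Set.mem_Ioi, hu, this, if_true, Pi.one_apply, mul_one]
        rw [← Real.exp_add]
        congr 1
        field_simp
        ring
      · have : ¬ r < r + u / r := by
          have : u / r ≤ 0 := div_nonpos_of_nonpos_of_nonneg (not_lt.1 hu) hr.le
          linarith
        simp only [hh, Set.indicator, Set.mem_Ioi, hu, this, if_false, mul_zero]
    rw [h3, integral_const_mul, h2, h1]
    ring
  have lim : Tendsto (fun r : ℝ =>
      ∫ u, (Set.Ioi (0 : ℝ)).indicator (fun u => Real.exp (-2 * u - (u / r) ^ 2)) u) atTop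
      (𝓝 (∫ u, (Set.Ioi (0 : ℝ)).indicator (fun u => Real.exp (-2 * u)) u)) := by
    apply tendsto_integral_filter_of_dominated_convergence
      (fun u => (Set.Ioi (0 : ℝ)).indicator (fun u => Real.exp (-2 * u)) u)
    · refine Eventually.of_forall fun r => ?_
      exact (Measurable.indicator (by fun_prop) measurableSet_Ioi).aestronglyMeasurable
    · refine Eventually.of_forall fun r => Eventually.of_forall fun u => ?_
      by_cases hu : 0 < u
      · simp only [Set.indicator, Set.mem_Ioi, hu, if_true, Real.norm_eq_abs, Real.abs_exp]
        gcongr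
        have := sq_nonneg (u / r)
        linarith
      · simp [Set.indicator, hu]
    · exact (integrable_indicator_iff measurableSet_Ioi).2 (exp_neg_integrableOn_Ioi 0 two_pos)
    · refine Eventually.of_forall fun u => ?_
      by_cases hu : 0 < u
      · simp only [Set.indicator, Set.mem_Ioi, hu, if_true]
        have : Tendsto (fun r : ℝ => -2 * u - (u / r) ^ 2) atTop (𝓝 (-2 * u - 0 ^ 2)) :=
          tendsto_const_nhds.sub ((tendsto_const_nhds.div_atTop tendsto_id).pow 2)
        rw [zero_pow two_ne_zero, sub_zero] at this
        exact (Real.continuous_exp.tendsto _).comp this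
      · simp [Set.indicator, hu]
  have val : ∫ u, (Set.Ioi (0 : ℝ)).indicator (fun u => Real.exp (-2 * u)) u = 2⁻¹ := by
    rw [integral_indicator measurableSet_Ioi, integral_exp_mul_Ioi (by norm_num)]
    norm_num
  rw [val] at lim
  refine (lim.const_mul _).congr' ?_
  filter_upwards [eventually_gt_atTop 0] with r hr
  exact (key r hr).symm

lemma hasTail_weibullLaw {c β : ℝ} (hc : 0 < c) (hβ : 0 < β) :
    HasTail (fun x => (weibullLaw c β).real (Set.Ioi x)) c β ((√Real.pi)⁻¹ * 2⁻¹) := by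
  have h1 : Tendsto (fun x : ℝ => (x / β) ^ (c / 2)) atTop atTop :=
    (tendsto_rpow_atTop (by positivity)).comp (tendsto_id.atTop_div_const hβ)
  refine (tendsto_gaussianReal_half_Ioi.comp h1).congr' ?_
  filter_upwards [eventually_gt_atTop 0] with x hx
  have h2 : ((x / β) ^ (c / 2)) ^ 2 = (x / β) ^ c := by
    rw [← Real.rpow_natCast, ← Real.rpow_mul (by positivity)]
    congr 1
    push_cast
    ring
  have h3 : (fun v => β * oddPow (2 / c) v) ⁻¹' Set.Ioi x = Set.Ioi ((x / β) ^ (c / 2)) := by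
    ext v
    simp only [Set.mem_preimage, Set.mem_Ioi]
    have hr : 0 < 2 / c := by positivity
    rcases le_total 0 v with hv | hv
    · rw [oddPow_of_nonneg hr hv, ← div_lt_iff₀' hβ]
      have : v = (v ^ (2 / c)) ^ (c / 2) := by
        rw [← Real.rpow_mul hv]
        have : 2 / c * (c / 2) = 1 := by field_simp
        rw [this, Real.rpow_one]
      conv_rhs => rw [this]
      rw [Real.rpow_lt_rpow_iff (by positivity) (by positivity) (by positivity)]
    · rw [oddPow_of_nonpos hr hv]
      have h4 : 0 ≤ (-v) ^ (2 / c) := Real.rpow_nonneg (by linarith) _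
      have h5 : 0 ≤ (x / β) ^ (c / 2) := by positivity
      constructor
      · intro h
        nlinarith
      · intro h
        linarith
  simp only [Function.comp]
  rw [h2, weibullLaw, map_measureReal_apply (measurable_weibullMap hc β) measurableSet_Ioi, h3]

/-- The asymptotic relation, turned into a bound valid on the whole line. -/
lemma HasTail.exists_bound {T : ℝ → ℝ} {c α a : ℝ} (h : HasTail T c α a) (hc : 0 < c) (hα : 0 < α)
    (h0 : ∀ x, 0 ≤ T x) (h1 : ∀ x, T x ≤ 1) :
    ∃ C, 0 ≤ C ∧ ∀ z, T z * ((1 + (max z 0 / α) ^ (c / 2)) * Real.exp ((max z 0 / α) ^ c)) ≤ C := by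
  have e1 : ∀ᶠ x in atTop, T x * ((x / α) ^ (c / 2) * Real.exp ((x / α) ^ c)) < a + 1 :=
    h.eventually (gt_mem_nhds (by linarith))
  obtain ⟨z₀, hz₀⟩ := eventually_atTop.1 (e1.and (eventually_ge_atTop α))
  refine ⟨max (2 * (a + 1)) ((1 + (max z₀ 0 / α) ^ (c / 2)) * Real.exp ((max z₀ 0 / α) ^ c)),
    le_max_of_le_right (by positivity), fun z => ?_⟩
  rcases le_total z₀ z with hz | hz
  · apply le_max_of_le_left
    obtain ⟨hz1, hz2⟩ := hz₀ z hz
    have hz3 : 0 ≤ z := hα.le.trans hz2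
    rw [max_eq_left hz3]
    have hz4 : 1 ≤ (z / α) ^ (c / 2) :=
      Real.one_le_rpow ((one_le_div hα).2 hz2) (by positivity)
    have hz5 : 0 ≤ T z * Real.exp ((z / α) ^ c) := mul_nonneg (h0 z) (Real.exp_nonneg _)
    nlinarith
  · apply le_max_of_le_right
    have : 0 ≤ max z 0 / α := by positivity
    calc T z * ((1 + (max z 0 / α) ^ (c / 2)) * Real.exp ((max z 0 / α) ^ c))
        ≤ 1 * ((1 + (max z 0 / α) ^ (c / 2)) * Real.exp ((max z 0 / α) ^ c)) := by
          gcongr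
          exact h1 z
      _ ≤ _ := by
          rw [one_mul]
          gcongr

lemma HasTail.comp_mul {T : ℝ → ℝ} {c α a γ : ℝ} (h : HasTail T c α a) (hγ : 0 < γ) :
    HasTail (fun x => T (γ * x)) c (α / γ) a := by
  refine (h.comp (tendsto_id.const_mul_atTop hγ)).congr fun x => ?_
  simp only [Function.comp, id]
  have : γ * x / α = x / (α / γ) := by field_simp
  rw [this]

/-! ### The phase function of Laplace's method -/

/-- The remaining distance `1 - t`, where `t = p ^ ((c - 1) / c) sgn(s) |s| ^ (2 / c)` is the
fraction of the level reached by the Gaussian-driven summand, truncated at `0` and measured in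
units of the scale `(1 - p) ^ ((c - 1) / c)` of the other summand. -/
noncomputable def gap (c p s : ℝ) : ℝ :=
  max (1 - p ^ ((c - 1) / c) * oddPow (2 / c) s) 0 / (1 - p) ^ ((c - 1) / c)

/-- The exponential cost of splitting a level between two summands of scales
`(1 - p) ^ ((c - 1) / c)` and `p ^ ((c - 1) / c)`, minus its minimum, which is attained where the
second summand takes the fraction `p`, that is at `s = √p`. -/
noncomputable def phase (c p s : ℝ) : ℝ := gap c p s ^ c + s ^ 2 - 1

lemma gap_nonneg {c p : ℝ} (hp1 : p < 1) (s : ℝ) : 0 ≤ gap c p s :=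
  div_nonneg (le_max_right _ _) (Real.rpow_nonneg (by linarith) _)

lemma div_rpow_scale {c q y : ℝ} (hc : 0 < c) (hq : 0 < q) (hy : 0 ≤ y) :
    (y / q ^ ((c - 1) / c)) ^ c = q * (y / q) ^ c := by
  rw [Real.div_rpow hy (by positivity), Real.div_rpow hy hq.le, ← Real.rpow_mul hq.le,
    div_mul_cancel₀ _ hc.ne', Real.rpow_sub_one hq.ne']
  field_simp

lemma continuous_gap {c p : ℝ} (hc : 0 < c) : Continuous (gap c p) :=
  ((continuous_const.sub (continuous_const.mul (continuous_oddPow (by positivity)))).max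
    continuous_const).div_const _

lemma continuous_phase {c p : ℝ} (hc : 0 < c) : Continuous (phase c p) :=
  (((continuous_gap hc).rpow_const fun _ => Or.inr hc.le).add (continuous_pow 2)).sub
    continuous_const

/-- `t` as a function of `s ≥ 0`, solved for `s ^ 2`. -/
lemma sq_eq_mul_div_rpow {c p s : ℝ} (hc : 0 < c) (hp0 : 0 < p) (hs : 0 ≤ s) :
    s ^ 2 = p * (p ^ ((c - 1) / c) * s ^ (2 / c) / p) ^ c := by
  rw [← div_rpow_scale hc hp0 (by positivity), mul_div_cancel_left₀ _ (by positivity),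
    ← Real.rpow_mul hs, div_mul_cancel₀ _ hc.ne', Real.rpow_two]

lemma scale_mul_sqrt_rpow {c p : ℝ} (hc : 0 < c) (hp0 : 0 < p) :
    p ^ ((c - 1) / c) * √p ^ (2 / c) = p := by
  rw [Real.sqrt_eq_rpow, ← Real.rpow_mul hp0.le, ← Real.rpow_add hp0]
  have : (c - 1) / c + 1 / 2 * (2 / c) = 1 := by field_simp; ring
  rw [this, Real.rpow_one]

/-- Bernoulli's inequality, strict for the second summand, at `t = p` for both powers: the
linear terms cancel. -/
lemma phase_pos {c p s : ℝ} (hc : 1 < c) (hp0 : 0 < p) (hp1 : p < 1) (hs : s ≠ √p) :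
    0 < phase c p s := by
  have hc0 : 0 < c := by linarith
  have hr : 0 < 2 / c := by positivity
  have hq : 0 < 1 - p := by linarith
  have hg : 0 ≤ gap c p s ^ c := Real.rpow_nonneg (gap_nonneg hp1 s) c
  rcases lt_or_ge s 0 with h | h
  · have h1 : 1 ≤ gap c p s := by
      rw [gap, one_le_div (by positivity)]
      refine le_max_of_le_left ?_
      have e1 : (1 - p) ^ ((c - 1) / c) ≤ 1 :=
        Real.rpow_le_one hq.le (by linarith) (div_nonneg (by linarith) hc0.le)
      have e2 : oddPow (2 / c) s ≤ 0 := by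
        rw [oddPow_of_nonpos hr h.le]
        have := Real.rpow_nonneg (neg_nonneg.2 h.le) (2 / c)
        linarith
      have e3 : p ^ ((c - 1) / c) * oddPow (2 / c) s ≤ 0 :=
        mul_nonpos_of_nonneg_of_nonpos (by positivity) e2
      linarith
    have h2 : 1 ≤ gap c p s ^ c := Real.one_le_rpow h1 hc0.le
    have h3 : 0 < s ^ 2 := by nlinarith
    unfold phase
    linarith
  · have h1 := sq_eq_mul_div_rpow hc0 hp0 h
    set t := p ^ ((c - 1) / c) * s ^ (2 / c) with ht
    have ht0 : 0 ≤ t := by positivity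
    have htp : t ≠ p := by
      intro e
      rw [e, div_self hp0.ne', Real.one_rpow, mul_one] at h1
      exact hs (by rw [← h1, Real.sqrt_sq h])
    have h2 : p + c * (t - p) < s ^ 2 := by
      have := one_add_mul_self_lt_rpow_one_add (s := t / p - 1) (p := c)
        (by have : 0 ≤ t / p := by positivity
            linarith)
        (fun e => htp (by rwa [sub_eq_zero, div_eq_one_iff_eq hp0.ne'] at e)) hc
      rw [add_sub_cancel] at this
      rw [h1]
      calc p + c * (t - p) = p * (1 + c * (t / p - 1)) := by field_simp
        _ < _ := mul_lt_mul_of_pos_left this hp0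
    have h3 : 1 - p + c * (p - t) ≤ gap c p s ^ c := by
      rw [gap, oddPow_of_nonneg hr h, ← ht, div_rpow_scale hc0 hq (le_max_right _ _)]
      have := one_add_mul_self_le_rpow_one_add (s := max (1 - t) 0 / (1 - p) - 1) (p := c)
        (by have : 0 ≤ max (1 - t) 0 / (1 - p) := by positivity
            linarith) hc.le
      rw [add_sub_cancel] at this
      calc 1 - p + c * (p - t) ≤ 1 - p + c * (max (1 - t) 0 - (1 - p)) := by
            have := mul_le_mul_of_nonneg_left (le_max_left (1 - t) 0) hc0.le
            linarith
        _ = (1 - p) * (1 + c * (max (1 - t) 0 / (1 - p) - 1)) := by field_simp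
        _ ≤ _ := mul_le_mul_of_nonneg_left this hq.le
    unfold phase
    linarith

lemma gap_sqrt {c p : ℝ} (hc : 0 < c) (hp0 : 0 < p) (hp1 : p < 1) :
    gap c p √p ^ c = 1 - p := by
  have hq : 0 < 1 - p := by linarith
  rw [gap, oddPow_of_nonneg (by positivity) (Real.sqrt_nonneg p), scale_mul_sqrt_rpow hc hp0,
    max_eq_left hq.le, div_rpow_scale hc hq hq.le, div_self hq.ne', Real.one_rpow, mul_one]

lemma phase_sqrt {c p : ℝ} (hc : 0 < c) (hp0 : 0 < p) (hp1 : p < 1) : phase c p √p = 0 := by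
  rw [phase, gap_sqrt hc hp0 hp1, Real.sq_sqrt hp0.le]
  ring

/-- The minimum of `phase` is quadratic. The first derivative vanishes at `√p`, so that
l'Hôpital's rule reduces the quotient to half the difference quotient of the derivative. -/
lemma tendsto_phase_div_sq {c p : ℝ} (hc : 1 < c) (hp0 : 0 < p) (hp1 : p < 1) :
    Tendsto (fun s => phase c p s / (s - √p) ^ 2) (𝓝[≠] √p)
      (𝓝 (2 * (c - 1) / (c * (1 - p)))) := by
  have hc0 : 0 < c := by linarith
  have hr : 0 < 2 / c := by positivity
  have hq : 0 < 1 - p := by linarith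
  set r := 2 / c with hrdef
  set β := p ^ ((c - 1) / c) with hβ
  have hcr : c * r = 2 := by rw [hrdef]; field_simp
  have hsp : 0 < √p := Real.sqrt_pos.2 hp0
  have hβp : β * √p ^ r = p := scale_mul_sqrt_rpow hc0 hp0
  set h : ℝ → ℝ := fun s => (1 - β * s ^ r) / (1 - p) with hh
  have hh1 : h √p = 1 := by simp only [hh]; rw [hβp, div_self hq.ne']
  have hcont : ContinuousAt h √p :=
    (continuousAt_const.sub (continuousAt_const.mul
      (Real.continuousAt_rpow_const _ _ (Or.inl hsp.ne')))).div_const _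
  have ev : ∀ᶠ s in 𝓝 √p, 0 < s ∧ 0 < h s :=
    (lt_mem_nhds hsp).and (hcont.eventually (lt_mem_nhds (by rw [hh1]; exact one_pos)))
  have hdh : ∀ s, 0 < s → HasDerivAt h (-(β * (r * s ^ (r - 1))) / (1 - p)) s := by
    intro s hs
    have := (((Real.hasDerivAt_rpow_const (p := r) (Or.inl hs.ne')).const_mul β).const_sub
      1).div_const (1 - p)
    simpa using this
  set f' : ℝ → ℝ := fun s => -2 * β * (h s ^ (c - 1) * s ^ (r - 1)) + 2 * s with hf'
  have ephase : ∀ s, 0 < s → 0 < h s → phase c p s = (1 - p) * h s ^ c + s ^ 2 - 1 := by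
    intro s hs hhs
    have h1 : 0 ≤ 1 - β * s ^ r := by
      have := mul_pos hhs hq
      simp only [hh] at this
      rw [div_mul_cancel₀ _ hq.ne'] at this
      exact this.le
    rw [phase, gap, oddPow_of_nonneg hr hs.le, max_eq_left h1, div_rpow_scale hc0 hq h1]
  have hd : ∀ s, 0 < s → 0 < h s → HasDerivAt (phase c p) (f' s) s := by
    intro s hs hhs
    have h1 : HasDerivAt (fun s => (1 - p) * h s ^ c + s ^ 2 - 1) (f' s) s := by
      have := ((((hdh s hs).rpow_const (p := c) (Or.inl hhs.ne')).const_mul (1 - p)).add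
        (hasDerivAt_pow 2 s)).sub_const 1
      refine this.congr_deriv ?_
      simp only [hf']
      have : (1 - p) * (-(β * (r * s ^ (r - 1))) / (1 - p) * c * h s ^ (c - 1)) =
          -(c * r) * β * (h s ^ (c - 1) * s ^ (r - 1)) := by field_simp
      rw [this, hcr]
      norm_num
    refine h1.congr_of_eventuallyEq ?_
    have e1 : ∀ᶠ y in 𝓝 s, 0 < h y := (hdh s hs).continuousAt.eventually (lt_mem_nhds hhs)
    filter_upwards [lt_mem_nhds hs, e1] with y hy hhy
    exact ephase y hy hhy
  have f'0 : f' √p = 0 := by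
    simp only [hf']
    rw [hh1, Real.one_rpow, one_mul, Real.rpow_sub_one hsp.ne', mul_assoc, ← mul_div_assoc, hβp]
    have : p / √p = √p := Real.div_sqrt
    rw [this]
    ring
  have hd2 : HasDerivAt f' (2 * (2 * (c - 1) / (c * (1 - p)))) √p := by
    have h1 := (((hdh _ hsp).rpow_const (p := c - 1) (Or.inl (by rw [hh1]; exact one_ne_zero))).mul
      (Real.hasDerivAt_rpow_const (p := r - 1) (Or.inl hsp.ne'))).const_mul (-2 * β)
    have h2 := h1.add ((hasDerivAt_id √p).const_mul 2)
    refine h2.congr_deriv ?_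
    rw [hh1, Real.one_rpow, Real.one_rpow, Real.rpow_sub_one hsp.ne', Real.rpow_sub_one hsp.ne',
      Real.rpow_sub_one hsp.ne']
    have e1 : √p ^ r = p / β := by
      rw [eq_div_iff (by positivity), mul_comm, hβp]
    have e2 : √p * √p = p := Real.mul_self_sqrt hp0.le
    have hβ0 : β ≠ 0 := by positivity
    have e3 : √p ^ r / √p / √p = 1 / β := by
      rw [e1, div_div, e2]; field_simp
    have e4 : √p ^ r / √p * (√p ^ r / √p) = p / β ^ 2 := by
      rw [div_mul_div_comm, e2, e1]; field_simp
    have e5 : -(β * (r * (√p ^ r / √p))) / (1 - p) * (c - 1) * 1 * (√p ^ r / √p) =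
        -(β * r / (1 - p) * (c - 1)) * (√p ^ r / √p * (√p ^ r / √p)) := by ring
    have e6 : (1 : ℝ) * ((r - 1) * (√p ^ r / √p / √p)) = (r - 1) / β := by rw [e3]; ring
    rw [e5, e4, e6, hrdef]
    field_simp
    ring
  have lim : Tendsto (fun s => f' s / (2 * (s - √p))) (𝓝[≠] √p)
      (𝓝 (2 * (c - 1) / (c * (1 - p)))) := by
    have h1 := (hasDerivAt_iff_tendsto_slope.1 hd2).div_const 2
    rw [mul_div_cancel_left₀ _ two_ne_zero] at h1
    refine h1.congr fun s => ?_
    rw [slope_def_field, f'0, sub_zero, div_div, mul_comm]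
  refine HasDerivAt.lhopital_zero_nhdsNE (f' := f') (g' := fun s => 2 * (s - √p))
    ?_ ?_ ?_ ?_ ?_ lim
  · filter_upwards [nhdsWithin_le_nhds ev] with s hs
    exact hd s hs.1 hs.2
  · refine Eventually.of_forall fun s => ?_
    exact (((hasDerivAt_id s).sub_const √p).pow 2).congr_deriv (by simp)
  · filter_upwards [self_mem_nhdsWithin] with s hs
    exact mul_ne_zero two_ne_zero (sub_ne_zero.2 hs)
  · have := (continuous_phase (c := c) (p := p) hc0).tendsto √p
    rw [phase_sqrt hc0 hp0 hp1] at this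
    exact this.mono_left nhdsWithin_le_nhds
  · have : Continuous fun s : ℝ => (s - √p) ^ 2 := by fun_prop
    have := this.tendsto √p
    rw [sub_self, zero_pow two_ne_zero] at this
    exact this.mono_left nhdsWithin_le_nhds

lemma exists_mul_sq_le_phase {c p : ℝ} (hc : 1 < c) (hp0 : 0 < p) (hp1 : p < 1) :
    ∃ m, 0 < m ∧ ∀ s, m * (s - √p) ^ 2 ≤ phase c p s := by
  have hc0 : 0 < c := by linarith
  have hq : 0 < 1 - p := by linarith
  set K := 2 * (c - 1) / (c * (1 - p)) with hK
  have hKpos : 0 < K := div_pos (by linarith) (by positivity)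
  have hsp : 0 < √p := Real.sqrt_pos.2 hp0
  have hsp1 : √p < 1 := by
    rw [Real.sqrt_lt' one_pos]; linarith
  have h1 : ∀ᶠ s in 𝓝[≠] √p, K / 2 < phase c p s / (s - √p) ^ 2 :=
    (tendsto_phase_div_sq hc hp0 hp1).eventually (lt_mem_nhds (by linarith))
  obtain ⟨δ, hδ, hδ'⟩ := Metric.eventually_nhds_iff.1 (eventually_nhdsWithin_iff.1 h1)
  -- Near the minimum the quadratic limit decides, at infinity the term `s ^ 2`, and in between
  -- compactness and positivity.
  obtain ⟨ε, hε, hε'⟩ : ∃ ε, 0 < ε ∧ ∀ s ∈ Set.Icc (-2 : ℝ) 2, δ ≤ dist s √p → ε ≤ phase c p s := by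
    have hcomp : IsCompact (Set.Icc (-2 : ℝ) 2 ∩ {s | δ ≤ dist s √p}) :=
      isCompact_Icc.inter_right
        (isClosed_le continuous_const (continuous_id.dist continuous_const))
    rcases Set.eq_empty_or_nonempty (Set.Icc (-2 : ℝ) 2 ∩ {s | δ ≤ dist s √p}) with he | hne
    · refine ⟨1, one_pos, fun s hs hs' => ?_⟩
      exact absurd (show s ∈ Set.Icc (-2 : ℝ) 2 ∩ {s | δ ≤ dist s √p} from ⟨hs, hs'⟩)
        (by rw [he]; exact Set.notMem_empty s)
    · obtain ⟨s₀, hs₀, hmin⟩ := hcomp.exists_isMinOn hne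
        (continuous_phase (c := c) (p := p) hc0).continuousOn
      refine ⟨phase c p s₀, phase_pos hc hp0 hp1 ?_, fun s hs hs' => hmin ⟨hs, hs'⟩⟩
      rintro rfl
      have := hs₀.2
      simp only [Set.mem_ofPred_eq, dist_self] at this
      linarith
  refine ⟨min (K / 2) (min (1 / 4) (ε / 9)), by positivity, fun s => ?_⟩
  have hm1 := min_le_left (K / 2) (min (1 / 4) (ε / 9))
  have hm2 := (min_le_right (K / 2) (min (1 / 4) (ε / 9))).trans (min_le_left _ _)
  have hm3 := (min_le_right (K / 2) (min (1 / 4) (ε / 9))).trans (min_le_right _ _)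
  set m := min (K / 2) (min (1 / 4) (ε / 9))
  have hsq := sq_nonneg (s - √p)
  by_cases hs : s ∈ Set.Icc (-2 : ℝ) 2
  · rcases le_or_gt δ (dist s √p) with hd | hd
    · have := hε' s hs hd
      have h9 : (s - √p) ^ 2 ≤ 9 := by nlinarith [hs.1, hs.2]
      calc m * (s - √p) ^ 2 ≤ ε / 9 * 9 := by gcongr
        _ ≤ _ := by linarith
    · by_cases he : s = √p
      · rw [he, phase_sqrt hc0 hp0 hp1]
        simp
      · have h2 := hδ' hd he
        have h3 : 0 < (s - √p) ^ 2 := by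
          have := sub_ne_zero.2 he
          positivity
        rw [lt_div_iff₀ h3] at h2
        exact (mul_le_mul_of_nonneg_right hm1 hsq).trans h2.le
  · have h1 : 0 ≤ gap c p s ^ c := Real.rpow_nonneg (gap_nonneg hp1 s) c
    have h2 : s ^ 2 - 1 ≤ phase c p s := by
      unfold phase
      linarith
    have h3 : 1 / 4 * (s - √p) ^ 2 ≤ s ^ 2 - 1 := by
      rw [Set.mem_Icc, not_and_or, not_le, not_le] at hs
      rcases hs with hs | hs <;> nlinarith
    exact ((mul_le_mul_of_nonneg_right hm2 hsq).trans h3).trans h2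

/-! ### Sums for `c > 1` -/

lemma rpow_two_div_rpow_half {c R : ℝ} (hc : 0 < c) (hR : 0 ≤ R) : (R ^ (2 / c)) ^ (c / 2) = R := by
  rw [← Real.rpow_mul hR]
  have : 2 / c * (c / 2) = 1 := by field_simp
  rw [this, Real.rpow_one]

lemma rpow_two_div_rpow {c R : ℝ} (hc : 0 < c) (hR : 0 ≤ R) : (R ^ (2 / c)) ^ c = R ^ 2 := by
  rw [← Real.rpow_mul hR, div_mul_cancel₀ _ hc.ne', Real.rpow_two]

lemma rpow_half_mul_exp {c x : ℝ} (hx : 0 ≤ x) :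
    x ^ (c / 2) * Real.exp (x ^ c) = x ^ (c / 2) * Real.exp ((x ^ (c / 2)) ^ 2) := by
  rw [← Real.rpow_natCast (x ^ (c / 2)), ← Real.rpow_mul hx]
  congr 3
  push_cast
  ring

/-- Laplace's method. Adding an independent modified Weibull variable of scale
`p ^ ((c - 1) / c)` to a variable with tail scale `(1 - p) ^ ((c - 1) / c)` gives tail scale `1`,
and multiplies the constant by `√(c / (2 (c - 1)))`. In the coordinate
`v = √p R + u`, where the level is `x = R ^ (2 / c)`, the integrand converges without any further
rescaling of `u`. -/
theorem HasTail.add_weibull_aux {T : ℝ → ℝ} {c p a : ℝ} (hc : 1 < c) (hp0 : 0 < p) (hp1 : p < 1)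
    (hT : Antitone T) (h0 : ∀ x, 0 ≤ T x) (h1 : ∀ x, T x ≤ 1)
    (h : HasTail T c ((1 - p) ^ ((c - 1) / c)) a) :
    HasTail (fun x => ∫ v, T (x - p ^ ((c - 1) / c) * oddPow (2 / c) v) ∂gaussianReal 0 (1 / 2))
      c 1 (a * √(c / (2 * (c - 1)))) := by
  have hc0 : 0 < c := by linarith
  have hr : 0 < 2 / c := by positivity
  have hq : 0 < 1 - p := by linarith
  have hsp : 0 < √p := Real.sqrt_pos.2 hp0
  set α := (1 - p) ^ ((c - 1) / c) with hα
  set β := p ^ ((c - 1) / c) with hβ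
  have hα0 : 0 < α := by positivity
  set K := 2 * (c - 1) / (c * (1 - p)) with hK
  have hKpos : 0 < K := div_pos (by linarith) (by positivity)
  obtain ⟨C, hC0, hC⟩ := h.exists_bound hc0 hα0 h0 h1
  obtain ⟨m, hm, hphase⟩ := exists_mul_sq_le_phase hc hp0 hp1
  set κ : ℝ → ℝ := fun s => gap c p s ^ (c / 2) with hκ
  have hκ0 : ∀ s, 0 ≤ κ s := fun s => Real.rpow_nonneg (gap_nonneg hp1 s) _
  have hκc : Continuous κ :=
    (continuous_gap hc0).rpow_const fun _ => Or.inr (by positivity)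
  have hκp : κ √p = √(1 - p) := by
    have : κ √p ^ 2 = 1 - p := by
      rw [← gap_sqrt hc0 hp0 hp1]
      simp only [hκ]
      rw [← Real.rpow_natCast, ← Real.rpow_mul (gap_nonneg hp1 _)]
      congr 1
      push_cast
      ring
    rw [← this, Real.sqrt_sq (hκ0 _)]
  have hκpos : 0 < κ √p := by rw [hκp]; exact Real.sqrt_pos.2 hq
  obtain ⟨δ, hδ, hδκ⟩ : ∃ δ > 0, ∀ s, dist s √p < δ → κ √p / 2 < κ s :=
    Metric.eventually_nhds_iff.1
      ((hκc.tendsto √p).eventually (lt_mem_nhds (half_lt_self hκpos)))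
  -- The integrand after translation and normalization.
  set F : ℝ → ℝ → ℝ := fun R u => Real.exp (-(√p * R + u) ^ 2) *
    T (R ^ (2 / c) - β * oddPow (2 / c) (√p * R + u)) * (R * Real.exp (R ^ 2)) with hF
  have hgap : ∀ s, max (1 - β * oddPow (2 / c) s) 0 / α = gap c p s := fun s => rfl
  have harg : ∀ R u, 0 < R → R ^ (2 / c) - β * oddPow (2 / c) (√p * R + u) =
      R ^ (2 / c) * (1 - β * oddPow (2 / c) (√p + u / R)) := by
    intro R u hR
    have : √p * R + u = R * (√p + u / R) := by field_simp
    rw [this, oddPow_mul hr hR.le]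
    ring
  have hexp : ∀ R u, 0 < R → -(√p * R + u) ^ 2 + R ^ 2 =
      R ^ 2 * gap c p (√p + u / R) ^ c - R ^ 2 * phase c p (√p + u / R) := by
    intro R u hR
    have : √p * R + u = R * (√p + u / R) := by field_simp
    rw [this, phase]
    ring
  have hbound : ∀ R u, 0 < R →
      ‖F R u‖ ≤ C * (2 / κ √p + |u| / δ) * Real.exp (-m * u ^ 2) := by
    intro R u hR
    set s := √p + u / R with hs
    set z := R ^ (2 / c) * (1 - β * oddPow (2 / c) s) with hz
    have hzα : max z 0 / α = R ^ (2 / c) * gap c p s := by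
      rw [← hgap, hz, mul_div_assoc', mul_max_of_nonneg _ _ (by positivity), mul_zero]
    have e1 : (max z 0 / α) ^ (c / 2) = R * κ s := by
      rw [hzα, Real.mul_rpow (by positivity) (gap_nonneg hp1 s), rpow_two_div_rpow_half hc0 hR.le]
    have e2 : (max z 0 / α) ^ c = R ^ 2 * gap c p s ^ c := by
      rw [hzα, Real.mul_rpow (by positivity) (gap_nonneg hp1 s), rpow_two_div_rpow hc0 hR.le]
    have hCz := hC z
    rw [e1, e2] at hCz
    have hden : 0 < 1 + R * κ s := by have := mul_nonneg hR.le (hκ0 s); linarith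
    have hFeq : F R u = T z * ((1 + R * κ s) * Real.exp (R ^ 2 * gap c p s ^ c)) *
        (R / (1 + R * κ s)) * Real.exp (-(R ^ 2 * phase c p s)) := by
      have e3 : Real.exp (-(√p * R + u) ^ 2) * Real.exp (R ^ 2) =
          Real.exp (R ^ 2 * gap c p s ^ c) * Real.exp (-(R ^ 2 * phase c p s)) := by
        rw [← Real.exp_add, ← Real.exp_add, hexp R u hR, sub_eq_add_neg]
      simp only [hF]
      rw [harg R u hR, ← hz]
      calc _ = T z * R * (Real.exp (-(√p * R + u) ^ 2) * Real.exp (R ^ 2)) := by ring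
        _ = _ := by
          rw [e3]
          field_simp
    have hus : u = R * (s - √p) := by rw [hs]; field_simp; ring
    -- Near `√p` the gap is bounded below; away from it `R` is at most a multiple of `|u|`.
    have hratio : R / (1 + R * κ s) ≤ 2 / κ √p + |u| / δ := by
      rcases lt_or_ge (dist s √p) δ with hd | hd
      · have h2 := hδκ s hd
        calc R / (1 + R * κ s) ≤ 2 / κ √p := by
              rw [div_le_div_iff₀ hden hκpos]
              nlinarith
          _ ≤ _ := le_add_of_nonneg_right (by positivity)
      · calc R / (1 + R * κ s) ≤ R :=
              div_le_self hR.le (le_add_of_nonneg_right (mul_nonneg hR.le (hκ0 s)))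
          _ ≤ |u| / δ := by
              rw [le_div_iff₀ hδ, hus, abs_mul, abs_of_pos hR]
              exact mul_le_mul_of_nonneg_left hd hR.le
          _ ≤ _ := le_add_of_nonneg_left (by positivity)
    have hexp2 : Real.exp (-(R ^ 2 * phase c p s)) ≤ Real.exp (-m * u ^ 2) := by
      apply Real.exp_le_exp.2
      have := mul_le_mul_of_nonneg_left (hphase s) (sq_nonneg R)
      rw [hus]
      linarith
    have hTz := h0 z
    rw [hFeq, Real.norm_of_nonneg (by positivity)]
    gcongr
  have hbi : Integrable fun u => C * (2 / κ √p + |u| / δ) * Real.exp (-m * u ^ 2) := by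
    have i1 := (integrable_exp_neg_mul_sq hm).const_mul (C * (2 / κ √p))
    have i2 := (integrable_mul_exp_neg_mul_sq hm).norm.const_mul (C / δ)
    refine (i1.add i2).congr (Eventually.of_forall fun u => ?_)
    simp only [Pi.add_apply, norm_mul, Real.norm_eq_abs, Real.abs_exp]
    ring
  have hlim : ∀ u, Tendsto (fun R => F R u) atTop (𝓝 (a / κ √p * Real.exp (-K * u ^ 2))) := by
    intro u
    have hs : Tendsto (fun R : ℝ => √p + u / R) atTop (𝓝 √p) := by
      have : Tendsto (fun R : ℝ => √p + u / R) atTop (𝓝 (√p + 0)) :=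
        tendsto_const_nhds.add (tendsto_const_nhds.div_atTop tendsto_id)
      rwa [add_zero] at this
    have hk : Tendsto (fun R : ℝ => 1 - β * oddPow (2 / c) (√p + u / R)) atTop (𝓝 (1 - p)) := by
      have := (((continuous_oddPow hr).tendsto _).comp hs).const_mul β |>.const_sub 1
      rwa [oddPow_of_nonneg hr hsp.le, scale_mul_sqrt_rpow hc0 hp0] at this
    have hz : Tendsto (fun R : ℝ => R ^ (2 / c) * (1 - β * oddPow (2 / c) (√p + u / R))) atTop
        atTop := (tendsto_rpow_atTop hr).atTop_mul_pos hq hk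
    have t1 := h.comp hz
    have t2 : Tendsto (fun R : ℝ => κ (√p + u / R)) atTop (𝓝 (κ √p)) := (hκc.tendsto _).comp hs
    have t3 : Tendsto (fun R : ℝ => R ^ 2 * phase c p (√p + u / R)) atTop (𝓝 (K * u ^ 2)) := by
      by_cases hu : u = 0
      · simp [hu, phase_sqrt hc0 hp0 hp1]
      · have hs' : Tendsto (fun R : ℝ => √p + u / R) atTop (𝓝[≠] √p) := by
          refine tendsto_nhdsWithin_iff.2 ⟨hs, ?_⟩
          filter_upwards [eventually_gt_atTop 0] with R hR
          have : u / R ≠ 0 := div_ne_zero hu hR.ne'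
          simpa using this
        refine (((tendsto_phase_div_sq hc hp0 hp1).comp hs').mul_const (u ^ 2)).congr' ?_
        filter_upwards [eventually_gt_atTop 0] with R hR
        simp only [Function.comp, add_sub_cancel_left]
        field_simp
    have t4 := (t1.div t2 hκpos.ne').mul ((Real.continuous_exp.tendsto _).comp t3.neg)
    rw [← neg_mul] at t4
    refine t4.congr' ?_
    filter_upwards [eventually_gt_atTop 0, hk.eventually (lt_mem_nhds hq),
      t2.eventually (lt_mem_nhds hκpos)] with R hR hkR hκR
    set s := √p + u / R with hsdef
    have hkα : R ^ (2 / c) * (1 - β * oddPow (2 / c) s) / α = R ^ (2 / c) * gap c p s := by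
      rw [← hgap, max_eq_left hkR.le, mul_div_assoc]
    simp only [Function.comp, Pi.div_apply]
    rw [← hsdef, hkα, Real.mul_rpow (by positivity) (gap_nonneg hp1 s),
      Real.mul_rpow (by positivity) (gap_nonneg hp1 s), rpow_two_div_rpow hc0 hR.le,
      rpow_two_div_rpow_half hc0 hR.le]
    have e3 : Real.exp (-(√p * R + u) ^ 2) * Real.exp (R ^ 2) =
        Real.exp (R ^ 2 * gap c p s ^ c) * Real.exp (-(R ^ 2 * phase c p s)) := by
      rw [← Real.exp_add, ← Real.exp_add, hexp R u hR, sub_eq_add_neg]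
    simp only [hF]
    rw [harg R u hR, ← hsdef]
    have hκR' : gap c p s ^ (c / 2) ≠ 0 := hκR.ne'
    calc _ = T (R ^ (2 / c) * (1 - β * oddPow (2 / c) s)) * R * (gap c p s ^ (c / 2) / κ s) *
          (Real.exp (R ^ 2 * gap c p s ^ c) * Real.exp (-(R ^ 2 * phase c p s))) := by ring
      _ = _ := by
        rw [← e3]
        simp only [hκ]
        rw [div_self hκR']
        ring
  have hmeas : ∀ R, AEStronglyMeasurable (F R) volume := by
    intro R
    have m1 : Measurable fun u : ℝ => R ^ (2 / c) - β * oddPow (2 / c) (√p * R + u) := by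
      have := (continuous_oddPow hr).measurable
      fun_prop
    have m2 := hT.measurable.comp m1
    exact ((Measurable.mul (by fun_prop) m2).mul_const _).aestronglyMeasurable
  have hDCT : Tendsto (fun R => ∫ u, F R u) atTop
      (𝓝 (∫ u, a / κ √p * Real.exp (-K * u ^ 2))) := by
    refine tendsto_integral_filter_of_dominated_convergence
      (fun u => C * (2 / κ √p + |u| / δ) * Real.exp (-m * u ^ 2))
      (Eventually.of_forall hmeas) ?_ hbi (Eventually.of_forall hlim)
    filter_upwards [eventually_gt_atTop 0] with R hR
    exact Eventually.of_forall fun u => hbound R u hR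
  rw [integral_const_mul, integral_gaussian] at hDCT
  have hval : (√Real.pi)⁻¹ * (a / κ √p * √(Real.pi / K)) = a * √(c / (2 * (c - 1))) := by
    have hc1 : 0 < c - 1 := by linarith
    have e : c / (2 * (c - 1)) = Real.pi⁻¹ * ((1 - p)⁻¹ * (Real.pi / K)) := by
      rw [hK]
      have := Real.pi_pos
      field_simp
    rw [e, Real.sqrt_mul (by positivity), Real.sqrt_mul (by positivity), Real.sqrt_inv,
      Real.sqrt_inv, hκp]
    ring
  have hfin := hDCT.const_mul (√Real.pi)⁻¹
  rw [hval] at hfin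
  have hRx : Tendsto (fun x : ℝ => x ^ (c / 2)) atTop atTop := tendsto_rpow_atTop (by positivity)
  refine (hfin.comp hRx).congr' ?_
  filter_upwards [eventually_gt_atTop 0] with x hx
  simp only [Function.comp]
  rw [div_one, rpow_half_mul_exp hx.le, integral_gaussianReal_half]
  set R := x ^ (c / 2) with hR
  have hxR : x = R ^ (2 / c) := by
    rw [hR, ← Real.rpow_mul hx.le]
    have : c / 2 * (2 / c) = 1 := by field_simp
    rw [this, Real.rpow_one]
  rw [hxR, mul_assoc, ← integral_mul_const,
    ← integral_add_left_eq_self (fun v => Real.exp (-v ^ 2) *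
      T (R ^ (2 / c) - p ^ ((c - 1) / c) * oddPow (2 / c) v) * (R * Real.exp (R ^ 2))) (√p * R)]

lemma integral_weibullLaw {c β : ℝ} (hc : 0 < c) {T : ℝ → ℝ} (hT : Antitone T) (x : ℝ) :
    ∫ y, T (x - y) ∂weibullLaw c β =
      ∫ v, T (x - β * oddPow (2 / c) v) ∂gaussianReal 0 (1 / 2) :=
  integral_map (measurable_weibullMap hc β).aemeasurable
    (hT.measurable.comp (by fun_prop)).aestronglyMeasurable

/-- For `c > 1` the scales of independent summands combine as in the `ℓ^(c / (c - 1))` norm. -/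
theorem HasTail.add_weibull {T : ℝ → ℝ} {c α β a : ℝ} (hc : 1 < c) (hα : 0 < α) (hβ : 0 < β)
    (hT : Antitone T) (h0 : ∀ x, 0 ≤ T x) (h1 : ∀ x, T x ≤ 1) (h : HasTail T c α a) :
    HasTail (fun x => ∫ y, T (x - y) ∂weibullLaw c β) c
      ((α ^ (c / (c - 1)) + β ^ (c / (c - 1))) ^ ((c - 1) / c)) (a * √(c / (2 * (c - 1)))) := by
  have hc0 : 0 < c := by linarith
  have hc1 : 0 < c - 1 := by linarith
  set A := α ^ (c / (c - 1)) with hA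
  set B := β ^ (c / (c - 1)) with hB
  have hA0 : 0 < A := by positivity
  have hB0 : 0 < B := by positivity
  set γ := (A + B) ^ ((c - 1) / c) with hγ
  have hγ0 : 0 < γ := by positivity
  set p := B / (A + B) with hp
  have hp0 : 0 < p := by positivity
  have hq : 1 - p = A / (A + B) := by rw [hp]; field_simp; ring
  have hp1 : p < 1 := by have : 0 < 1 - p := by rw [hq]; positivity
                         linarith
  have inv : ∀ t : ℝ, 0 < t → (t ^ (c / (c - 1))) ^ ((c - 1) / c) = t := by
    intro t ht
    rw [← Real.rpow_mul ht.le]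
    have : c / (c - 1) * ((c - 1) / c) = 1 := by field_simp
    rw [this, Real.rpow_one]
  have eα : (1 - p) ^ ((c - 1) / c) = α / γ := by
    rw [hq, Real.div_rpow hA0.le (by positivity), hA, inv α hα]
  have eβ : p ^ ((c - 1) / c) = β / γ := by
    rw [hp, Real.div_rpow hB0.le (by positivity), hB, inv β hβ]
  have h2 := h.comp_mul hγ0
  rw [← eα] at h2
  have h3 := HasTail.add_weibull_aux hc hp0 hp1
    (hT.comp_monotone fun _ _ hxy => mul_le_mul_of_nonneg_left hxy hγ0.le)
    (fun x => h0 _) (fun x => h1 _) h2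
  have h4 := h3.comp_mul (inv_pos.2 hγ0)
  have eγ : 1 / γ⁻¹ = γ := by simp
  rw [eγ, eβ] at h4
  refine h4.congr fun x => ?_
  have e : ∀ v, γ * (γ⁻¹ * x - β / γ * oddPow (2 / c) v) = x - β * oddPow (2 / c) v := by
    intro v
    field_simp
  simp only [Function.comp, integral_weibullLaw hc0 hT, e]

/-! ### Sums for `c ≤ 1` -/

/-- The graph of a concave power lies below its tangents. -/
lemma rpow_sub_rpow_le {c z w : ℝ} (hc0 : 0 ≤ c) (hc1 : c ≤ 1) (hz : 0 ≤ z) (hw : 0 < w) :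
    z ^ c - w ^ c ≤ c * (z - w) * w ^ (c - 1) := by
  have h := rpow_one_add_le_one_add_mul_self (s := z / w - 1)
    (by have : 0 ≤ z / w := by positivity
        linarith) hc0 hc1
  rw [add_sub_cancel, Real.div_rpow hz hw.le, div_le_iff₀ (by positivity)] at h
  rw [Real.rpow_sub_one hw.ne']
  calc z ^ c - w ^ c ≤ (1 + c * (z / w - 1)) * w ^ c - w ^ c := by linarith
    _ = _ := by field_simp; ring

lemma tendsto_rpow_sub_rpow_sub {c : ℝ} (hc0 : 0 ≤ c) (hc1 : c < 1) (y : ℝ) :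
    Tendsto (fun x : ℝ => x ^ c - (x - y) ^ c) atTop (𝓝 0) := by
  have hx : Tendsto (fun x : ℝ => x ^ (c - 1)) atTop (𝓝 0) := by
    have := tendsto_rpow_neg_atTop (y := 1 - c) (by linarith)
    rwa [neg_sub] at this
  have hxy : Tendsto (fun x : ℝ => x - y) atTop atTop :=
    tendsto_atTop_add_const_right _ (-y) tendsto_id
  have l := hx.const_mul (c * y)
  have u := (hx.comp hxy).const_mul (c * y)
  rw [mul_zero] at l u
  refine tendsto_of_tendsto_of_tendsto_of_le_of_le' l u ?_ ?_
  · filter_upwards [eventually_gt_atTop 0, hxy.eventually_gt_atTop 0] with x h1 h2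
    have := rpow_sub_rpow_le hc0 hc1.le h2.le h1
    have e : c * (x - y - x) * x ^ (c - 1) = -(c * y * x ^ (c - 1)) := by ring
    rw [e] at this
    linarith
  · filter_upwards [eventually_gt_atTop 0, hxy.eventually_gt_atTop 0] with x h1 h2
    have := rpow_sub_rpow_le hc0 hc1.le h1.le h2
    have e : c * (x - (x - y)) = c * y := by ring
    rwa [e] at this

/-- The effect of shifting the level by a fixed `y`: none for `c < 1`, a factor `exp y` for
`c = 1`. -/
lemma HasTail.translate {T : ℝ → ℝ} {c a y l : ℝ} (h : HasTail T c 1 a)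
    (hl : Tendsto (fun x : ℝ => x ^ c - (x - y) ^ c) atTop (𝓝 l)) :
    Tendsto (fun x => T (x - y) * (x ^ (c / 2) * Real.exp (x ^ c))) atTop
      (𝓝 (a * Real.exp l)) := by
  have hxy : Tendsto (fun x : ℝ => x - y) atTop atTop :=
    tendsto_atTop_add_const_right _ (-y) tendsto_id
  have h1 := h.comp hxy
  have h2 : Tendsto (fun x : ℝ => (x / (x - y)) ^ (c / 2)) atTop (𝓝 1) := by
    have e : Tendsto (fun x : ℝ => 1 + y / (x - y)) atTop (𝓝 (1 + 0)) :=
      tendsto_const_nhds.add (tendsto_const_nhds.div_atTop hxy)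
    rw [add_zero] at e
    have e2 : Tendsto (fun x : ℝ => x / (x - y)) atTop (𝓝 1) := by
      refine e.congr' ?_
      filter_upwards [hxy.eventually_gt_atTop 0] with x hx
      field_simp
      ring
    have := e2.rpow_const (p := c / 2) (Or.inl one_ne_zero)
    rwa [Real.one_rpow] at this
  have h3 := (h1.mul h2).mul ((Real.continuous_exp.tendsto _).comp hl)
  rw [mul_one] at h3
  refine h3.congr' ?_
  filter_upwards [eventually_gt_atTop 0, hxy.eventually_gt_atTop 0] with x hx hx'
  simp only [Function.comp]
  have e3 : (x - y) ^ (c / 2) ≠ 0 := by positivity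
  rw [div_one, Real.exp_sub, Real.div_rpow hx.le hx'.le]
  have e4 := Real.exp_ne_zero ((x - y) ^ c)
  field_simp

/-- Integrability against `exp (θ |y| ^ c)` is preserved by convolution. -/
lemma integrable_exp_conv {P Q : Measure ℝ} [IsProbabilityMeasure P] [IsProbabilityMeasure Q]
    {c θ : ℝ} (hc0 : 0 < c) (hc1 : c ≤ 1) (hθ : 0 ≤ θ)
    (hP : Integrable (fun y => Real.exp (θ * |y| ^ c)) P)
    (hQ : Integrable (fun y => Real.exp (θ * |y| ^ c)) Q) :
    Integrable (fun y => Real.exp (θ * |y| ^ c)) (P ∗ Q) := by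
  have hcont : Continuous fun y : ℝ => Real.exp (θ * |y| ^ c) :=
    Real.continuous_exp.comp
      (continuous_const.mul (continuous_abs.rpow_const fun _ => Or.inr hc0.le))
  rw [Measure.conv, integrable_map_measure hcont.aestronglyMeasurable (by fun_prop)]
  refine (hP.mul_prod hQ).mono' (hcont.comp continuous_add).aestronglyMeasurable ?_
  refine Eventually.of_forall fun z => ?_
  simp only [Function.comp]
  rw [Real.norm_eq_abs, Real.abs_exp, ← Real.exp_add, ← mul_add]
  gcongr
  exact (Real.rpow_le_rpow (abs_nonneg _) (abs_add_le _ _) hc0.le).trans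
    (Real.rpow_add_le_add_rpow (abs_nonneg _) (abs_nonneg _) hc0.le hc1)

lemma integrable_exp_weibullLaw {c β θ : ℝ} (hc : 0 < c) (hβ : 0 ≤ β) (h : θ * β ^ c < 1) :
    Integrable (fun y => Real.exp (θ * |y| ^ c)) (weibullLaw c β) := by
  have hcont : Continuous fun y : ℝ => Real.exp (θ * |y| ^ c) :=
    Real.continuous_exp.comp
      (continuous_const.mul (continuous_abs.rpow_const fun _ => Or.inr hc.le))
  rw [weibullLaw, integrable_map_measure hcont.aestronglyMeasurable
    (measurable_weibullMap hc β).aemeasurable, gaussianReal_of_var_ne_zero 0 (by norm_num),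
    integrable_withDensity_iff_integrable_smul' (measurable_gaussianPDF _ _)
      (Eventually.of_forall fun _ => gaussianPDF_lt_top)]
  have hb : 0 < 1 - θ * β ^ c := by linarith
  refine ((integrable_exp_neg_mul_sq hb).const_mul (√Real.pi)⁻¹).congr
    (Eventually.of_forall fun v => ?_)
  have h1 : 2 * Real.pi * ((1 / 2 : NNReal) : ℝ) = Real.pi := by push_cast; ring
  have h2 : 2 * ((1 / 2 : NNReal) : ℝ) = 1 := by push_cast; ring
  have h3 : |β * oddPow (2 / c) v| ^ c = β ^ c * v ^ 2 := by
    rw [abs_mul, abs_oddPow (by positivity), abs_of_nonneg hβ,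
      Real.mul_rpow hβ (by positivity), rpow_two_div_rpow hc (abs_nonneg v), sq_abs]
  simp only [Function.comp]
  rw [toReal_gaussianPDF, gaussianPDFReal, h1, h2, sub_zero, div_one, smul_eq_mul, h3, mul_assoc,
    ← Real.exp_add]
  congr 2
  ring

/-- For `c = 1` a summand with a lighter exponential tail only contributes the constant factor
`∫ exp y`. -/
lemma HasTail.add_light {T : ℝ → ℝ} {Q : Measure ℝ} {a θ : ℝ} (hT : Antitone T)
    (h0 : ∀ x, 0 ≤ T x) (h1 : ∀ x, T x ≤ 1) (h : HasTail T 1 1 a) (hθ : 1 < θ)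
    (hQ : Integrable (fun y => Real.exp (θ * |y| ^ (1 : ℝ))) Q) :
    HasTail (fun x => ∫ y, T (x - y) ∂Q) 1 1 (a * ∫ y, Real.exp y ∂Q) := by
  obtain ⟨C, hC0, hC⟩ := h.exists_bound one_pos one_pos h0 h1
  have hθ' : 0 < θ - 1 := by linarith
  unfold HasTail
  simp_rw [div_one, ← integral_mul_const, ← integral_const_mul]
  refine tendsto_integral_filter_of_dominated_convergence
    (fun y => C * ((2 + 1 / (θ - 1)) * Real.exp (θ * |y| ^ (1 : ℝ)))) ?_ ?_
    ((hQ.const_mul _).const_mul C) ?_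
  · exact Eventually.of_forall fun x =>
      ((hT.measurable.comp (by fun_prop)).mul_const _).aestronglyMeasurable
  · filter_upwards [eventually_gt_atTop 0] with x hx
    refine Eventually.of_forall fun y => ?_
    have hCz := hC (x - y)
    simp only [div_one, Real.rpow_one] at hCz ⊢
    set z := max (x - y) 0 with hz
    have hz0 : 0 ≤ z := le_max_right _ _
    have hzx : x ≤ z + |y| := by
      have := le_max_left (x - y) 0
      have := le_abs_self y
      linarith
    have e1 : x ^ (1 / 2 : ℝ) ≤ (1 + z ^ (1 / 2 : ℝ)) * (1 + |y| ^ (1 / 2 : ℝ)) := by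
      have e2 := (Real.rpow_le_rpow hx.le hzx (by norm_num : (0 : ℝ) ≤ 1 / 2)).trans
        (Real.rpow_add_le_add_rpow hz0 (abs_nonneg y) (by norm_num) (by norm_num))
      have e3 : 0 ≤ z ^ (1 / 2 : ℝ) := by positivity
      have e4 : 0 ≤ |y| ^ (1 / 2 : ℝ) := by positivity
      nlinarith [mul_nonneg e3 e4]
    have e2 : Real.exp x ≤ Real.exp z * Real.exp |y| := by
      rw [← Real.exp_add]
      exact Real.exp_le_exp.2 hzx
    have e3 : 1 + |y| ^ (1 / 2 : ℝ) ≤ (2 + 1 / (θ - 1)) * Real.exp ((θ - 1) * |y|) := by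
      have f1 : |y| ^ (1 / 2 : ℝ) ≤ 1 + |y| := by
        rw [← Real.sqrt_eq_rpow, Real.sqrt_le_left (by positivity)]
        nlinarith [abs_nonneg y]
      have f2 : (θ - 1) * |y| ≤ Real.exp ((θ - 1) * |y|) := by
        have := Real.add_one_le_exp ((θ - 1) * |y|)
        linarith
      have f3 : 1 ≤ Real.exp ((θ - 1) * |y|) := Real.one_le_exp (by positivity)
      have f4 : |y| ≤ 1 / (θ - 1) * Real.exp ((θ - 1) * |y|) := by
        rw [div_mul_eq_mul_div, one_mul, le_div_iff₀ hθ']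
        linarith
      linarith
    have hTz := h0 (x - y)
    rw [Real.norm_of_nonneg (by positivity)]
    calc T (x - y) * (x ^ (1 / 2 : ℝ) * Real.exp x)
        ≤ T (x - y) * (((1 + z ^ (1 / 2 : ℝ)) * (1 + |y| ^ (1 / 2 : ℝ))) *
            (Real.exp z * Real.exp |y|)) := by gcongr
      _ = T (x - y) * ((1 + z ^ (1 / 2 : ℝ)) * Real.exp z) *
            ((1 + |y| ^ (1 / 2 : ℝ)) * Real.exp |y|) := by ring
      _ ≤ C * (((2 + 1 / (θ - 1)) * Real.exp ((θ - 1) * |y|)) * Real.exp |y|) := by gcongr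
      _ = _ := by
        rw [mul_assoc (2 + 1 / (θ - 1)), ← Real.exp_add]
        ring_nf
  · refine Eventually.of_forall fun y => h.translate ?_
    simp

/-- For `c < 1`, one large summand: the contribution to a large sum of the event that the
summand of law `P` is at most half the level. -/
lemma HasTail.integral_Iic_half {T : ℝ → ℝ} {P : Measure ℝ} {c b : ℝ} [IsProbabilityMeasure P]
    (hc0 : 0 < c) (hc1 : c < 1) (hT : Antitone T) (h0 : ∀ x, 0 ≤ T x) (h1 : ∀ x, T x ≤ 1)
    (h : HasTail T c 1 b) (hP : Integrable (fun y => Real.exp (c * |y| ^ c)) P) :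
    HasTail (fun x => ∫ y, (Set.Iic (x / 2)).indicator (fun y => T (x - y)) y ∂P) c 1 b := by
  obtain ⟨C, hC0, hC⟩ := h.exists_bound hc0 one_pos h0 h1
  unfold HasTail
  simp_rw [div_one, ← integral_mul_const]
  have hb : ∫ _, b ∂P = b := by simp
  rw [← hb]
  refine tendsto_integral_filter_of_dominated_convergence
    (fun y => C * 2 ^ (c / 2) * Real.exp (c * |y| ^ c)) ?_ ?_ (hP.const_mul _) ?_
  · exact Eventually.of_forall fun x =>
      (((hT.measurable.comp (by fun_prop)).indicator measurableSet_Iic).mul_const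
        _).aestronglyMeasurable
  · filter_upwards [eventually_gt_atTop 0] with x hx
    refine Eventually.of_forall fun y => ?_
    by_cases hy : y ≤ x / 2
    · simp only [Set.indicator, Set.mem_Iic, hy, if_true]
      have hz : 0 < x - y := by linarith
      have hCz := hC (x - y)
      rw [max_eq_left hz.le, div_one] at hCz
      set z := x - y with hzdef
      have e1 : x ^ (c / 2) ≤ 2 ^ (c / 2) * (1 + z ^ (c / 2)) := by
        have : x ^ (c / 2) ≤ (2 * z) ^ (c / 2) :=
          Real.rpow_le_rpow hx.le (by linarith) (by positivity)
        rw [Real.mul_rpow zero_le_two hz.le] at this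
        have : (0 : ℝ) ≤ 2 ^ (c / 2) := by positivity
        linarith
      have e2 : x ^ c ≤ z ^ c + c * |y| ^ c := by
        rcases le_or_gt y 0 with hy0 | hy0
        · have : x ^ c ≤ z ^ c := Real.rpow_le_rpow hx.le (by linarith) hc0.le
          have : 0 ≤ c * |y| ^ c := by positivity
          linarith
        · have t1 := rpow_sub_rpow_le hc0.le hc1.le hx.le hz
          have t2 : z ^ (c - 1) ≤ y ^ (c - 1) :=
            Real.rpow_le_rpow_of_nonpos hy0 (by linarith) (by linarith)
          have t3 : y * y ^ (c - 1) = y ^ c := by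
            rw [Real.rpow_sub_one hy0.ne']
            field_simp
          have t4 : c * (x - z) * z ^ (c - 1) ≤ c * y ^ c := by
            rw [hzdef, sub_sub_cancel, ← hzdef, ← t3, mul_assoc]
            gcongr
          rw [abs_of_pos hy0]
          linarith
      have hTz := h0 z
      rw [Real.norm_of_nonneg (by positivity)]
      calc T z * (x ^ (c / 2) * Real.exp (x ^ c))
          ≤ T z * ((2 ^ (c / 2) * (1 + z ^ (c / 2))) * Real.exp (z ^ c + c * |y| ^ c)) := by
            gcongr
        _ = T z * ((1 + z ^ (c / 2)) * Real.exp (z ^ c)) *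
              (2 ^ (c / 2) * Real.exp (c * |y| ^ c)) := by
            rw [Real.exp_add]
            ring
        _ ≤ C * (2 ^ (c / 2) * Real.exp (c * |y| ^ c)) := by gcongr
        _ = _ := by ring
    · simp only [Set.indicator, Set.mem_Iic, hy, if_false, zero_mul, norm_zero]
      positivity
  · refine Eventually.of_forall fun y => ?_
    have := h.translate (tendsto_rpow_sub_rpow_sub hc0.le hc1 y)
    rw [Real.exp_zero, mul_one] at this
    refine this.congr' ?_
    filter_upwards [eventually_ge_atTop (2 * y)] with x hx
    rw [Set.indicator_of_mem]
    simp only [Set.mem_Iic]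
    linarith

lemma measureReal_prod_eq_integral (P Q : Measure ℝ) [IsProbabilityMeasure P]
    [IsProbabilityMeasure Q] {E : Set (ℝ × ℝ)} (hE : MeasurableSet E) :
    (P.prod Q).real E = ∫ x, Q.real (Prod.mk x ⁻¹' E) ∂P := by
  rw [← integral_indicator_one hE, integral_prod _ ((integrable_const 1).indicator hE)]
  congr 1
  ext x
  rw [← integral_indicator_one (measurable_prodMk_left hE)]
  rfl

/-- A sum exceeds `x` with its first summand at most `x / 2`, or with its second one at most
`x / 2`, or with both above `x / 2`. -/
lemma real_conv_Ioi_eq_add (P Q : Measure ℝ) [IsProbabilityMeasure P] [IsProbabilityMeasure Q]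
    (x : ℝ) :
    (P ∗ Q).real (Set.Ioi x) =
      (∫ y, (Set.Iic (x / 2)).indicator (fun y => Q.real (Set.Ioi (x - y))) y ∂P) +
      (∫ y, (Set.Iic (x / 2)).indicator (fun y => P.real (Set.Ioi (x - y))) y ∂Q) +
      P.real (Set.Ioi (x / 2)) * Q.real (Set.Ioi (x / 2)) := by
  have half : ∀ (P Q : Measure ℝ) [IsProbabilityMeasure P] [IsProbabilityMeasure Q],
      (P.prod Q).real {z | x < z.1 + z.2 ∧ z.1 ≤ x / 2} =
        ∫ y, (Set.Iic (x / 2)).indicator (fun y => Q.real (Set.Ioi (x - y))) y ∂P := by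
    intro P Q _ _
    rw [measureReal_prod_eq_integral P Q (by measurability)]
    congr 1
    ext y
    by_cases hy : y ≤ x / 2
    · rw [Set.indicator_of_mem (Set.mem_Iic.2 hy)]
      congr 1
      ext z
      simp [hy, sub_lt_iff_lt_add']
    · rw [Set.indicator_of_notMem (by simpa using hy)]
      have : Prod.mk y ⁻¹' {z : ℝ × ℝ | x < z.1 + z.2 ∧ z.1 ≤ x / 2} = ∅ := by
        ext z
        simp [hy]
      rw [this, measureReal_empty]
  have swap : (P.prod Q).real {z | x < z.1 + z.2 ∧ z.2 ≤ x / 2} =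
      (Q.prod P).real {z | x < z.1 + z.2 ∧ z.1 ≤ x / 2} := by
    rw [← Measure.prod_swap, map_measureReal_apply measurable_swap (by measurability)]
    congr 1
    ext z
    simp [add_comm]
  have m1 : MeasurableSet {z : ℝ × ℝ | x < z.1 + z.2 ∧ z.2 ≤ x / 2} := by measurability
  have hset : (fun z : ℝ × ℝ => z.1 + z.2) ⁻¹' Set.Ioi x =
      ({z | x < z.1 + z.2 ∧ z.1 ≤ x / 2} ∪ {z | x < z.1 + z.2 ∧ z.2 ≤ x / 2}) ∪
        Set.Ioi (x / 2) ×ˢ Set.Ioi (x / 2) := by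
    ext z
    simp only [Set.mem_preimage, Set.mem_Ioi, Set.mem_union, Set.mem_ofPred_eq, Set.mem_prod]
    constructor
    · intro h
      by_cases h1 : z.1 ≤ x / 2
      · exact Or.inl (Or.inl ⟨h, h1⟩)
      · by_cases h2 : z.2 ≤ x / 2
        · exact Or.inl (Or.inr ⟨h, h2⟩)
        · exact Or.inr ⟨not_le.1 h1, not_le.1 h2⟩
    · rintro ((h | h) | h)
      · exact h.1
      · exact h.1
      · linarith [h.1, h.2]
  rw [Measure.conv, map_measureReal_apply (by fun_prop) measurableSet_Ioi, hset,
    measureReal_union _ (measurableSet_Ioi.prod measurableSet_Ioi), measureReal_union _ m1, half,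
    swap, half, measureReal_prod_prod]
  · rw [Set.disjoint_left]
    rintro z ⟨h1, h2⟩ ⟨-, h3⟩
    linarith
  · rw [Set.disjoint_left]
    rintro z (⟨-, h1⟩ | ⟨-, h1⟩) ⟨h2, h3⟩
    · exact not_lt.2 h1 h2
    · exact not_lt.2 h1 h3

/-- For `c < 1` the tail constants add up, as for all subexponential laws. -/
theorem HasTail.conv {P Q : Measure ℝ} {c a b : ℝ} [IsProbabilityMeasure P]
    [IsProbabilityMeasure Q] (hc0 : 0 < c) (hc1 : c < 1)
    (hP : HasTail (fun x => P.real (Set.Ioi x)) c 1 a)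
    (hQ : HasTail (fun x => Q.real (Set.Ioi x)) c 1 b)
    (hPi : Integrable (fun y => Real.exp (c * |y| ^ c)) P)
    (hQi : Integrable (fun y => Real.exp (c * |y| ^ c)) Q) :
    HasTail (fun x => (P ∗ Q).real (Set.Ioi x)) c 1 (a + b) := by
  have t1 := hQ.integral_Iic_half hc0 hc1 (antitone_real_Ioi Q) (fun _ => measureReal_nonneg)
    (fun _ => measureReal_le_one) hPi
  have t2 := hP.integral_Iic_half hc0 hc1 (antitone_real_Ioi P) (fun _ => measureReal_nonneg)
    (fun _ => measureReal_le_one) hQi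
  -- Two large summands together are negligible, since `x ^ c ≤ 2 (x / 2) ^ c` and the product has
  -- an additional power `x ^ (-c / 2)`.
  have t3 : HasTail (fun x => P.real (Set.Ioi (x / 2)) * Q.real (Set.Ioi (x / 2))) c 1 0 := by
    have hx2 : Tendsto (fun x : ℝ => x / 2) atTop atTop := tendsto_id.atTop_div_const two_pos
    have s1 := (hP.comp hx2).mul (hQ.comp hx2)
    have s2 : Tendsto (fun x : ℝ => (4 : ℝ) ^ (c / 2) * x ^ (-(c / 2))) atTop (𝓝 0) := by
      have := (tendsto_rpow_neg_atTop (y := c / 2) (by positivity)).const_mul ((4 : ℝ) ^ (c / 2))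
      rwa [mul_zero] at this
    have s3 := s1.mul s2
    rw [mul_zero] at s3
    refine squeeze_zero' ?_ ?_ s3
    · filter_upwards [eventually_gt_atTop 0] with x hx
      positivity
    · filter_upwards [eventually_gt_atTop 0] with x hx
      simp only [Function.comp, div_one]
      have e1 : x ^ c ≤ (x / 2) ^ c + (x / 2) ^ c := by
        have := Real.rpow_add_le_add_rpow (half_pos hx).le (half_pos hx).le hc0.le hc1.le
        rwa [add_halves] at this
      have e2 : x ^ (c / 2) = (x / 2) ^ (c / 2) * (x / 2) ^ (c / 2) *
          ((4 : ℝ) ^ (c / 2) * x ^ (-(c / 2))) := by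
        rw [Real.rpow_neg hx.le, ← Real.mul_rpow (by positivity) (by positivity), mul_comm _ _⁻¹,
          mul_left_comm, ← Real.mul_rpow (by positivity) (by positivity)]
        have : x / 2 * (x / 2) * 4 = x * x := by ring
        rw [this, Real.mul_rpow hx.le hx.le]
        have : x ^ (c / 2) ≠ 0 := by positivity
        field_simp
      calc P.real (Set.Ioi (x / 2)) * Q.real (Set.Ioi (x / 2)) *
            (x ^ (c / 2) * Real.exp (x ^ c))
          ≤ P.real (Set.Ioi (x / 2)) * Q.real (Set.Ioi (x / 2)) *
            (x ^ (c / 2) * Real.exp ((x / 2) ^ c + (x / 2) ^ c)) := by gcongr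
        _ = _ := by
          rw [Real.exp_add, e2]
          ring
  have t := (t1.add t2).add t3
  rw [add_zero, add_comm b a] at t
  refine t.congr fun x => ?_
  simp only [real_conv_Ioi_eq_add P Q]
  ring

/-! ### Comparison of tails -/

/-- The tails `P (x, ∞)` and `P [x, ∞)` have the same asymptotics, whether or not `P` has atoms:
an atom at `x` is counted in `P (y, ∞)` for all `y < x`. -/
lemma HasTail.real_Ici {P : Measure ℝ} {c α a : ℝ} [IsProbabilityMeasure P] (hα : 0 < α)
    (h : HasTail (fun x => P.real (Set.Ioi x)) c α a) :
    HasTail (fun x => P.real (Set.Ici x)) c α a := by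
  unfold HasTail at h ⊢
  rw [tendsto_order] at h ⊢
  refine ⟨fun b hb => ?_, fun b hb => ?_⟩
  · filter_upwards [h.1 b hb, eventually_gt_atTop (0 : ℝ)] with x hx hx0
    exact hx.trans_le (mul_le_mul_of_nonneg_right (measureReal_mono Set.Ioi_subset_Ici_self)
      (by positivity))
  · obtain ⟨b', hb1, hb2⟩ := exists_between hb
    obtain ⟨y₀, hy₀⟩ := eventually_atTop.1 (h.2 b' hb1)
    filter_upwards [eventually_gt_atTop y₀, eventually_gt_atTop 0] with x hx hx0
    refine lt_of_le_of_lt ?_ hb2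
    have hcont : ContinuousAt
        (fun y : ℝ => P.real (Set.Ici x) * ((y / α) ^ (c / 2) * Real.exp ((y / α) ^ c))) x := by
      have hne : x / α ≠ 0 := by positivity
      have h1 : ContinuousAt (fun y : ℝ => y / α) x := continuousAt_id.div_const α
      exact continuousAt_const.mul ((h1.rpow_const (Or.inl hne)).mul
        (Real.continuous_exp.continuousAt.comp (h1.rpow_const (Or.inl hne))))
    refine le_of_tendsto (x := 𝓝[<] x) (hcont.tendsto.mono_left nhdsWithin_le_nhds) ?_
    have e1 : ∀ᶠ y in 𝓝[<] x, max y₀ 0 < y :=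
      nhdsWithin_le_nhds (lt_mem_nhds (max_lt hx hx0))
    filter_upwards [e1, self_mem_nhdsWithin] with y hy hyx
    have hy0 : 0 < y := (le_max_right _ _).trans_lt hy
    refine le_trans ?_ (hy₀ y ((le_max_left _ _).trans hy.le)).le
    have hsub : Set.Ici x ⊆ Set.Ioi y := Set.Ici_subset_Ioi.2 hyx
    exact mul_le_mul_of_nonneg_right (measureReal_mono hsub) (by positivity)

lemma HasTail.tendsto_div {T U : ℝ → ℝ} {c α a b : ℝ} (hα : 0 < α) (hT : HasTail T c α a)
    (hU : HasTail U c α b) (hb : b ≠ 0) : Tendsto (fun x => T x / U x) atTop (𝓝 (a / b)) := by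
  refine (Tendsto.div hT hU hb).congr' ?_
  filter_upwards [eventually_gt_atTop 0] with x hx
  simp only [Pi.div_apply]
  exact mul_div_mul_right _ _ (by positivity)

lemma integral_exp_mul_real_Ioi_le {P : Measure ℝ} [IsProbabilityMeasure P] {c θ x : ℝ}
    (hc : 0 < c) (hθ : 0 ≤ θ) (hx : 0 ≤ x)
    (h : Integrable (fun y => Real.exp (θ * |y| ^ c)) P) :
    Real.exp (θ * x ^ c) * P.real (Set.Ioi x) ≤ ∫ y, Real.exp (θ * |y| ^ c) ∂P := by
  refine le_trans ?_ (mul_meas_ge_le_integral_of_nonneg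
    (Eventually.of_forall fun y => Real.exp_nonneg _) h (Real.exp (θ * x ^ c)))
  refine mul_le_mul_of_nonneg_left (measureReal_mono fun y hy => ?_) (Real.exp_nonneg _)
  have hxy : x < y := hy
  have : x ^ c ≤ |y| ^ c := Real.rpow_le_rpow hx (hxy.le.trans (le_abs_self y)) hc.le
  exact Real.exp_le_exp.2 (mul_le_mul_of_nonneg_left this hθ)

/-- A law with an exponential moment of order `θ > 1` has a negligible tail at scale `1`. -/
lemma hasTail_zero_of_integrable {P : Measure ℝ} [IsProbabilityMeasure P] {c θ : ℝ}
    (hc : 0 < c) (hθ : 1 < θ) (h : Integrable (fun y => Real.exp (θ * |y| ^ c)) P) :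
    HasTail (fun x => P.real (Set.Ioi x)) c 1 0 := by
  have h1 : Tendsto (fun x : ℝ => (x ^ c) ^ (1 / 2 : ℝ) * Real.exp (-(θ - 1) * x ^ c)) atTop
      (𝓝 0) :=
    (tendsto_rpow_mul_exp_neg_mul_atTop_nhds_zero (1 / 2) (θ - 1) (by linarith)).comp
      (tendsto_rpow_atTop hc)
  have h2 := h1.const_mul (∫ y, Real.exp (θ * |y| ^ c) ∂P)
  rw [mul_zero] at h2
  refine squeeze_zero' ?_ ?_ h2
  · filter_upwards [eventually_gt_atTop 0] with x hx
    positivity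
  · filter_upwards [eventually_gt_atTop 0] with x hx
    have hm := integral_exp_mul_real_Ioi_le hc (by linarith : 0 ≤ θ) hx.le h
    have e1 : (x ^ c) ^ (1 / 2 : ℝ) = x ^ (c / 2) := by
      rw [← Real.rpow_mul hx.le]
      congr 1
      ring
    have e2 : Real.exp (x ^ c) = Real.exp (θ * x ^ c) * Real.exp (-(θ - 1) * x ^ c) := by
      rw [← Real.exp_add]
      congr 1
      ring
    rw [div_one, e1, e2]
    calc _ = (Real.exp (θ * x ^ c) * P.real (Set.Ioi x)) *
          (x ^ (c / 2) * Real.exp (-(θ - 1) * x ^ c)) := by ring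
      _ ≤ _ := by gcongr

/-! ### Weighted sums of independent variables -/

section WeightedSums

variable {Ω ι : Type*} [MeasurableSpace Ω] {μ : Measure Ω} {c χ : ℝ}
  {X : ι → Ω → ℝ}

lemma aemeasurable_sum_mul (hX : ∀ i, AEMeasurable (X i) μ) (w : ι → ℝ) (s : Finset ι) :
    AEMeasurable (fun ω => ∑ i ∈ s, w i * X i ω) μ :=
  Finset.aemeasurable_fun_sum s fun i _ => (hX i).const_mul (w i)

variable [IsProbabilityMeasure μ] [DecidableEq ι]

lemma map_sum_insert (hc : 0 < c) (hχ : 0 < χ) (hX : ∀ i, IsModifiedWeibull (X i) c χ μ)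
    (hindep : iIndepFun X μ) (w : ι → ℝ) {s : Finset ι} {i : ι} (hi : i ∉ s) :
    μ.map (fun ω => ∑ j ∈ insert i s, w j * X j ω) =
      μ.map (fun ω => ∑ j ∈ s, w j * X j ω) ∗ weibullLaw c (|w i| * χ) := by
  have hm : ∀ j, AEMeasurable (fun ω => w j * X j ω) μ := fun j => ((hX j).1).const_mul (w j)
  have h1 : iIndepFun (fun j ω => w j * X j ω) μ :=
    hindep.comp (fun j x => w j * x) fun j => measurable_const_mul (w j)
  have h2 := h1.indepFun_finsetSum_of_notMem₀ hm hi
  have e : (∑ j ∈ s, fun ω => w j * X j ω) = fun ω => ∑ j ∈ s, w j * X j ω := by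
    ext ω
    simp
  rw [e] at h2
  rw [← (hX i).map_mul hc hχ (w i), ← h2.map_add_eq_map_conv_map₀
    (aemeasurable_sum_mul (fun j => (hX j).1) w s) (hm i)]
  congr 1
  ext ω
  simp [Finset.sum_insert hi, add_comm]

/-- Upper tail of a weighted sum for `c > 1`. The first nonvanishing summand brings the constant
`1 / (2 √π)` and every further one a factor `√(c / (2 (c - 1)))`, hence the division. -/
theorem hasTail_sum_of_one_lt (hc : 1 < c) (hχ : 0 < χ)
    (hX : ∀ i, IsModifiedWeibull (X i) c χ μ) (hindep : iIndepFun X μ) (w : ι → ℝ)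
    (s : Finset ι) :
    (∀ i ∈ s, w i = 0) ∨
      0 < ∑ i ∈ s, |w i| ^ (c / (c - 1)) ∧
      HasTail (fun x => (μ.map (fun ω => ∑ i ∈ s, w i * X i ω)).real (Set.Ioi x)) c
        ((∑ i ∈ s, |w i| ^ (c / (c - 1))) ^ ((c - 1) / c) * χ)
        ((√Real.pi)⁻¹ * 2⁻¹ * (√(c / (2 * (c - 1))) ^ (s.filter fun i => w i ≠ 0).card /
          √(c / (2 * (c - 1))))) := by
  have hc0 : 0 < c := by linarith
  have hc1 : 0 < c - 1 := by linarith
  have hD : 0 < √(c / (2 * (c - 1))) := by positivity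
  have hqinv : c / (c - 1) * ((c - 1) / c) = 1 := by field_simp
  have hqinv' : (c - 1) / c * (c / (c - 1)) = 1 := by field_simp
  induction s using Finset.induction_on with
  | empty => left; simp
  | insert i s hi ih =>
    by_cases hw : w i = 0
    · have e1 : ∀ ω, ∑ j ∈ insert i s, w j * X j ω = ∑ j ∈ s, w j * X j ω := by
        intro ω
        rw [Finset.sum_insert hi, hw, zero_mul, zero_add]
      have e2 : ∑ j ∈ insert i s, |w j| ^ (c / (c - 1)) = ∑ j ∈ s, |w j| ^ (c / (c - 1)) := by
        rw [Finset.sum_insert hi, hw, abs_zero, Real.zero_rpow (by positivity), zero_add]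
      have e3 : (insert i s).filter (fun i => w i ≠ 0) = s.filter fun i => w i ≠ 0 := by
        rw [Finset.filter_insert, if_neg (by simpa using hw)]
      simp only [e1, e2, e3]
      exact ih.imp_left fun h j hj => (Finset.mem_insert.1 hj).elim (fun e => e ▸ hw) (h j)
    · right
      have hwi : 0 < |w i| ^ (c / (c - 1)) := by positivity
      have e3 : ((insert i s).filter fun i => w i ≠ 0).card =
          (s.filter fun i => w i ≠ 0).card + 1 := by
        rw [Finset.filter_insert, if_pos hw, Finset.card_insert_of_notMem]
        exact fun h => hi (Finset.mem_filter.1 h).1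
      rw [e3, Finset.sum_insert hi]
      have hβ : 0 < |w i| * χ := by positivity
      rcases ih with h0 | ⟨hA, hs⟩
      · have e1 : ∀ ω, ∑ j ∈ insert i s, w j * X j ω = w i * X i ω := by
          intro ω
          rw [Finset.sum_insert hi, Finset.sum_eq_zero (s := s), add_zero]
          intro j hj
          rw [h0 j hj, zero_mul]
        have e2 : ∑ j ∈ s, |w j| ^ (c / (c - 1)) = 0 := by
          refine Finset.sum_eq_zero fun j hj => ?_
          rw [h0 j hj, abs_zero, Real.zero_rpow (by positivity)]
        have e4 : s.filter (fun i => w i ≠ 0) = ∅ :=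
          Finset.filter_eq_empty_iff.2 fun j hj h => h (h0 j hj)
        simp only [e1, (hX i).map_mul hc0 hχ]
        rw [e2, add_zero, e4, ← Real.rpow_mul (abs_nonneg _), hqinv, Real.rpow_one,
          Finset.card_empty, zero_add, pow_one, div_self hD.ne', mul_one]
        exact ⟨hwi, hasTail_weibullLaw hc0 hβ⟩
      · refine ⟨by positivity, ?_⟩
        have := isProbabilityMeasure_weibullLaw hc0 (|w i| * χ)
        have : IsProbabilityMeasure (μ.map fun ω => ∑ j ∈ s, w j * X j ω) :=
          Measure.isProbabilityMeasure_map (aemeasurable_sum_mul (fun j => (hX j).1) w s)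
        have h1 := hs.add_weibull hc (by positivity) hβ (antitone_real_Ioi _)
          (fun _ => measureReal_nonneg) (fun _ => measureReal_le_one)
        simp only [map_sum_insert hc0 hχ hX hindep w hi, real_conv_Ioi]
        convert h1 using 1
        · set A := ∑ j ∈ s, |w j| ^ (c / (c - 1))
          rw [Real.mul_rpow (by positivity) hχ.le, Real.mul_rpow (by positivity) hχ.le,
            ← Real.rpow_mul hA.le, hqinv', Real.rpow_one, ← add_mul,
            Real.mul_rpow (by positivity) (by positivity), ← Real.rpow_mul hχ.le, hqinv,
            Real.rpow_one, add_comm]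
        · rw [pow_succ]
          field_simp

lemma integrable_exp_sum (hc0 : 0 < c) (hc1 : c ≤ 1) (hχ : 0 < χ)
    (hX : ∀ i, IsModifiedWeibull (X i) c χ μ) (hindep : iIndepFun X μ) (w : ι → ℝ) {θ : ℝ}
    (hθ : 0 ≤ θ) (s : Finset ι) (hw : ∀ i ∈ s, θ * (|w i| * χ) ^ c < 1) :
    Integrable (fun y => Real.exp (θ * |y| ^ c)) (μ.map fun ω => ∑ i ∈ s, w i * X i ω) := by
  induction s using Finset.induction_on with
  | empty =>
    simp only [Finset.sum_empty, Measure.map_const, measure_univ, one_smul]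
    exact integrable_dirac (by simp)
  | insert i s hi ih =>
    have := isProbabilityMeasure_weibullLaw hc0 (|w i| * χ)
    have : IsProbabilityMeasure (μ.map fun ω => ∑ j ∈ s, w j * X j ω) :=
      Measure.isProbabilityMeasure_map (aemeasurable_sum_mul (fun j => (hX j).1) w s)
    rw [map_sum_insert hc0 hχ hX hindep w hi]
    exact integrable_exp_conv hc0 hc1 hθ (ih fun j hj => hw j (Finset.mem_insert_of_mem hj))
      (integrable_exp_weibullLaw hc0 (by positivity) (hw i (Finset.mem_insert_self i s)))

/-- Upper tail of a weighted sum for `c < 1`, the scales being at most `1`: the summands of scale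
`1` are counted. -/
theorem hasTail_sum_of_lt_one (hc0 : 0 < c) (hc1 : c < 1) (hχ : 0 < χ)
    (hX : ∀ i, IsModifiedWeibull (X i) c χ μ) (hindep : iIndepFun X μ) (w : ι → ℝ)
    (hw : ∀ i, |w i| * χ ≤ 1) (s : Finset ι) :
    HasTail (fun x => (μ.map (fun ω => ∑ i ∈ s, w i * X i ω)).real (Set.Ioi x)) c 1
      ((√Real.pi)⁻¹ * 2⁻¹ * (s.filter fun i => |w i| * χ = 1).card) := by
  have hc2 : ∀ i, c * (|w i| * χ) ^ c < 1 := fun i =>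
    (mul_le_of_le_one_right hc0.le
      (Real.rpow_le_one (by positivity) (hw i) hc0.le)).trans_lt hc1
  induction s using Finset.induction_on with
  | empty =>
    have : IsProbabilityMeasure (μ.map fun ω => ∑ j ∈ (∅ : Finset ι), w j * X j ω) :=
      Measure.isProbabilityMeasure_map (aemeasurable_sum_mul (fun j => (hX j).1) w ∅)
    rw [Finset.filter_empty, Finset.card_empty, Nat.cast_zero, mul_zero]
    exact hasTail_zero_of_integrable hc0 one_lt_two
      (integrable_exp_sum hc0 hc1.le hχ hX hindep w zero_le_two ∅ (by simp))
  | insert i s hi ih =>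
    have := isProbabilityMeasure_weibullLaw hc0 (|w i| * χ)
    have : IsProbabilityMeasure (μ.map fun ω => ∑ j ∈ s, w j * X j ω) :=
      Measure.isProbabilityMeasure_map (aemeasurable_sum_mul (fun j => (hX j).1) w s)
    have hI := integrable_exp_sum hc0 hc1.le hχ hX hindep w hc0.le s fun j _ => hc2 j
    have hJ := integrable_exp_weibullLaw (β := |w i| * χ) hc0 (by positivity) (hc2 i)
    rw [map_sum_insert hc0 hχ hX hindep w hi]
    by_cases h : |w i| * χ = 1
    · have hQ := hasTail_weibullLaw (β := |w i| * χ) hc0 (by rw [h]; exact one_pos)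
      nth_rw 2 [h] at hQ
      have := ih.conv hc0 hc1 hQ hI hJ
      convert this using 1
      rw [Finset.filter_insert, if_pos h, Finset.card_insert_of_notMem
        (fun h => hi (Finset.mem_filter.1 h).1)]
      push_cast
      ring
    · have hlt : (|w i| * χ) ^ c < 1 :=
        Real.rpow_lt_one (by positivity) (lt_of_le_of_ne (hw i) h) hc0
      have hnn : 0 ≤ (|w i| * χ) ^ c := by positivity
      have hQ := hasTail_zero_of_integrable (P := weibullLaw c (|w i| * χ))
        (θ := 2 / (1 + (|w i| * χ) ^ c)) hc0
        (by rw [lt_div_iff₀ (by positivity)]; linarith)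
        (integrable_exp_weibullLaw hc0 (by positivity)
          (by rw [div_mul_eq_mul_div, div_lt_one (by positivity)]; linarith))
      have := ih.conv hc0 hc1 hQ hI hJ
      rw [Finset.filter_insert, if_neg h]
      rwa [add_zero] at this

/-- Upper tail of a weighted sum for `c = 1`, exactly one scale being `1` and the others less. -/
theorem hasTail_sum_of_eq_one (hχ : 0 < χ)
    (hX : ∀ i, IsModifiedWeibull (X i) 1 χ μ) (hindep : iIndepFun X μ) (w : ι → ℝ)
    {s : Finset ι} {i : ι} (hi : i ∉ s) (hwi : |w i| * χ = 1) (hw : ∀ j ∈ s, |w j| * χ < 1) :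
    ∃ l, 0 < l ∧
      HasTail (fun x => (μ.map (fun ω => ∑ j ∈ insert i s, w j * X j ω)).real (Set.Ioi x)) 1 1
        ((√Real.pi)⁻¹ * 2⁻¹ * l) := by
  have hθ : ∀ᶠ θ : ℝ in 𝓝 1, ∀ j ∈ s, θ * (|w j| * χ) ^ (1 : ℝ) < 1 := by
    rw [Finset.eventually_all]
    intro j hj
    have : Tendsto (fun θ : ℝ => θ * (|w j| * χ) ^ (1 : ℝ)) (𝓝 1)
        (𝓝 (1 * (|w j| * χ) ^ (1 : ℝ))) := tendsto_id.mul_const _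
    refine this.eventually (gt_mem_nhds ?_)
    rw [one_mul, Real.rpow_one]
    exact hw j hj
  obtain ⟨θ, hθw, hθ1⟩ := ((hθ.filter_mono nhdsWithin_le_nhds).and
    (self_mem_nhdsWithin (a := (1 : ℝ)) (s := Set.Ioi 1))).exists
  have hθ1' : 1 < θ := hθ1
  have := isProbabilityMeasure_weibullLaw one_pos (|w i| * χ)
  have : IsProbabilityMeasure (μ.map fun ω => ∑ j ∈ s, w j * X j ω) :=
    Measure.isProbabilityMeasure_map (aemeasurable_sum_mul (fun j => (hX j).1) w s)
  have hI := integrable_exp_sum one_pos le_rfl hχ hX hindep w (by linarith : 0 ≤ θ) s hθw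
  have hexp : Integrable Real.exp (μ.map fun ω => ∑ j ∈ s, w j * X j ω) := by
    refine hI.mono' Real.continuous_exp.aestronglyMeasurable (Eventually.of_forall fun y => ?_)
    rw [Real.norm_eq_abs, Real.abs_exp, Real.rpow_one]
    refine Real.exp_le_exp.2 ((le_abs_self y).trans ?_)
    nlinarith [abs_nonneg y]
  refine ⟨_, integral_exp_pos hexp, ?_⟩
  simp only [map_sum_insert one_pos hχ hX hindep w hi]
  rw [Measure.conv_comm]
  simp only [real_conv_Ioi]
  have hQ := hasTail_weibullLaw (β := |w i| * χ) one_pos (by rw [hwi]; exact one_pos)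
  nth_rw 2 [hwi] at hQ
  exact hQ.add_light (antitone_real_Ioi _) (fun _ => measureReal_nonneg)
    (fun _ => measureReal_le_one) hθ1' hI

end WeightedSums

/-! ### Tail ratios to a modified Weibull variable -/

section TailRatios

variable {Ω Ω' : Type*} [MeasurableSpace Ω] [MeasurableSpace Ω'] {μ : Measure Ω} {ν : Measure Ω'}
  [IsProbabilityMeasure μ] [IsProbabilityMeasure ν] {S : Ω → ℝ} {Z : Ω' → ℝ} {c γ l : ℝ}

/-- The reference variable `Z` has the exact constant `1 / (2 √π)` at scale `γ`, so the tail ratio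
is the remaining factor `l`. -/
lemma upperTailRatio_of_hasTail (hc : 0 < c) (hγ : 0 < γ) (hS : AEMeasurable S μ)
    (h : HasTail (fun x => (μ.map S).real (Set.Ioi x)) c γ ((√Real.pi)⁻¹ * 2⁻¹ * l))
    (hZ : IsModifiedWeibull Z c γ ν) : UpperTailRatio S μ Z ν l := by
  have : IsProbabilityMeasure (μ.map S) := Measure.isProbabilityMeasure_map hS
  have : IsProbabilityMeasure (ν.map Z) := Measure.isProbabilityMeasure_map hZ.1
  have hκ : (√Real.pi)⁻¹ * 2⁻¹ ≠ 0 := by positivity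
  have hlaw : ν.map Z = weibullLaw c γ := by
    have := hZ.map_mul hc hγ 1
    simpa using this
  have e : ∀ (P : Measure ℝ) [IsProbabilityMeasure P] (x : ℝ),
      1 - cdf P x = P.real (Set.Ioi x) := by
    intro P _ x
    rw [cdf_eq_real, ← Set.compl_Iic, probReal_compl_eq_one_sub measurableSet_Iic]
  unfold UpperTailRatio
  simp only [e]
  have h2 := hasTail_weibullLaw hc hγ
  rw [← hlaw] at h2
  have := h.tendsto_div hγ h2 hκ
  rwa [mul_div_cancel_left₀ _ hκ] at this

lemma lowerTailRatio_of_hasTail (hc : 0 < c) (hγ : 0 < γ) (hS : AEMeasurable S μ)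
    (h : HasTail (fun x => (μ.map fun ω => -S ω).real (Set.Ioi x)) c γ
      ((√Real.pi)⁻¹ * 2⁻¹ * l))
    (hZ : IsModifiedWeibull Z c γ ν) : LowerTailRatio S μ Z ν l := by
  have : IsProbabilityMeasure (μ.map S) := Measure.isProbabilityMeasure_map hS
  have : IsProbabilityMeasure (ν.map Z) := Measure.isProbabilityMeasure_map hZ.1
  have : IsProbabilityMeasure (μ.map fun ω => -S ω) := Measure.isProbabilityMeasure_map hS.neg
  have : IsProbabilityMeasure (ν.map fun ω => -Z ω) := Measure.isProbabilityMeasure_map hZ.1.neg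
  have hκ : (√Real.pi)⁻¹ * 2⁻¹ ≠ 0 := by positivity
  have hlaw : (ν.map fun ω => -Z ω) = weibullLaw c γ := by
    have := hZ.map_mul hc hγ (-1)
    simpa using this
  have h2 := hasTail_weibullLaw hc hγ
  rw [← hlaw] at h2
  have h3 := (h.real_Ici hγ).tendsto_div hγ (h2.real_Ici hγ) hκ
  rw [mul_div_cancel_left₀ _ hκ] at h3
  refine (h3.comp tendsto_neg_atBot_atTop).congr fun x => ?_
  have hpre : Neg.neg ⁻¹' Set.Ici (-x) = Set.Iic x := by
    ext y
    simp
  have e1 : (μ.map fun ω => -S ω) = (μ.map S).map Neg.neg :=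
    (AEMeasurable.map_map_of_aemeasurable measurable_neg.aemeasurable hS).symm
  have e2 : (ν.map fun ω => -Z ω) = (ν.map Z).map Neg.neg :=
    (AEMeasurable.map_map_of_aemeasurable measurable_neg.aemeasurable hZ.1).symm
  simp only [Function.comp]
  rw [e1, e2, map_measureReal_apply measurable_neg measurableSet_Ici,
    map_measureReal_apply measurable_neg measurableSet_Ici, hpre, cdf_eq_real, cdf_eq_real]

end TailRatios

/-- Reduction to scale `1`. -/
lemma HasTail.of_map_inv_mul {Ω : Type*} [MeasurableSpace Ω] {μ : Measure Ω} {S : Ω → ℝ}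
    {c γ a : ℝ} (hγ : 0 < γ) (hS : AEMeasurable S μ)
    (h : HasTail (fun x => (μ.map fun ω => γ⁻¹ * S ω).real (Set.Ioi x)) c 1 a) :
    HasTail (fun x => (μ.map S).real (Set.Ioi x)) c γ a := by
  have h1 := h.comp_mul (inv_pos.2 hγ)
  rw [div_inv_eq_mul, one_mul] at h1
  have e : (μ.map fun ω => γ⁻¹ * S ω) = (μ.map S).map fun y => γ⁻¹ * y :=
    (AEMeasurable.map_map_of_aemeasurable (measurable_const_mul _).aemeasurable hS).symm
  have hpre : ∀ x, (fun y => γ⁻¹ * y) ⁻¹' Set.Ioi (γ⁻¹ * x) = Set.Ioi x := by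
    intro x
    ext y
    simp only [Set.mem_preimage, Set.mem_Ioi]
    exact mul_lt_mul_iff_right₀ (inv_pos.2 hγ)
  simp only [e, map_measureReal_apply (measurable_const_mul γ⁻¹) measurableSet_Ioi, hpre] at h1
  exact h1

/-! ### The tail of the full sum at its natural scale -/

section NaturalScale

variable {Ω : Type*} [MeasurableSpace Ω] {μ : Measure Ω} [IsProbabilityMeasure μ] {N : ℕ}
  {c χ : ℝ} {X : Fin N → Ω → ℝ}

lemma hasTail_sum_univ_of_one_lt (hc : 1 < c) (hχ : 0 < χ)
    (hX : ∀ i, IsModifiedWeibull (X i) c χ μ) (hindep : iIndepFun X μ) (w : Fin N → ℝ)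
    (hw : ∃ i, w i ≠ 0) :
    0 < (∑ i, |w i| ^ (c / (c - 1))) ^ ((c - 1) / c) * χ ∧
      HasTail (fun x => (μ.map (fun ω => ∑ i, w i * X i ω)).real (Set.Ioi x)) c
        ((∑ i, |w i| ^ (c / (c - 1))) ^ ((c - 1) / c) * χ)
        ((√Real.pi)⁻¹ * 2⁻¹ *
          (c / (2 * (c - 1))) ^ (((Nat.card {i // w i ≠ 0} : ℝ) - 1) / 2)) := by
  have hc1 : 0 < c - 1 := by linarith
  have hD : 0 < c / (2 * (c - 1)) := by positivity
  obtain ⟨i, hi⟩ := hw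
  rcases hasTail_sum_of_one_lt hc hχ hX hindep w Finset.univ with h | ⟨h1, h2⟩
  · exact absurd (h i (Finset.mem_univ i)) hi
  · refine ⟨by positivity, ?_⟩
    convert h2 using 2
    rw [Nat.card_eq_fintype_card, Fintype.card_subtype, Real.sqrt_eq_rpow, ← Real.rpow_natCast,
      ← Real.rpow_mul hD.le, ← Real.rpow_sub hD]
    congr 1
    ring

lemma iSup_abs_pos {w : Fin N → ℝ} (hw : ∃ i, w i ≠ 0) : 0 < ⨆ i, |w i| := by
  obtain ⟨i, hi⟩ := hw
  exact (abs_pos.2 hi).trans_le (le_ciSup (f := fun i => |w i|) (Set.finite_range _).bddAbove i)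

lemma abs_inv_mul_mul_eq {M χ : ℝ} (hM : 0 < M) (hχ : 0 < χ) (v : ℝ) :
    |(M * χ)⁻¹ * v| * χ = |v| / M := by
  rw [abs_mul, abs_inv, abs_of_pos (mul_pos hM hχ)]
  field_simp

lemma hasTail_sum_univ_of_lt_one (hc0 : 0 < c) (hc1 : c < 1) (hχ : 0 < χ)
    (hX : ∀ i, IsModifiedWeibull (X i) c χ μ) (hindep : iIndepFun X μ) (w : Fin N → ℝ)
    (hw : ∃ i, w i ≠ 0) :
    HasTail (fun x => (μ.map (fun ω => ∑ i, w i * X i ω)).real (Set.Ioi x)) c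
      ((⨆ i, |w i|) * χ) ((√Real.pi)⁻¹ * 2⁻¹ * Nat.card {i // |w i| = ⨆ j, |w j|}) := by
  have hM := iSup_abs_pos hw
  set M := ⨆ i, |w i| with hMdef
  have hle : ∀ i, |w i| ≤ M := le_ciSup (f := fun i => |w i|) (Set.finite_range _).bddAbove
  refine HasTail.of_map_inv_mul (mul_pos hM hχ)
    (aemeasurable_sum_mul (fun j => (hX j).1) w _) ?_
  have h := hasTail_sum_of_lt_one hc0 hc1 hχ hX hindep (fun i => (M * χ)⁻¹ * w i)
    (fun i => by
      rw [abs_inv_mul_mul_eq hM hχ]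
      exact (div_le_one hM).2 (hle i)) Finset.univ
  simp only [abs_inv_mul_mul_eq hM hχ, div_eq_one_iff_eq hM.ne', mul_assoc, ← Finset.mul_sum] at h
  rw [Nat.card_eq_fintype_card, Fintype.card_subtype]
  simpa only [mul_assoc] using h

lemma hasTail_sum_univ_of_eq_one (hχ : 0 < χ)
    (hX : ∀ i, IsModifiedWeibull (X i) 1 χ μ) (hindep : iIndepFun X μ) (w : Fin N → ℝ)
    (hw : ∃ i, w i ≠ 0) (hu : ∃! i, |w i| = ⨆ j, |w j|) :
    ∃ l, 0 < l ∧ HasTail (fun x => (μ.map (fun ω => ∑ i, w i * X i ω)).real (Set.Ioi x)) 1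
      ((⨆ i, |w i|) * χ) ((√Real.pi)⁻¹ * 2⁻¹ * l) := by
  have hM := iSup_abs_pos hw
  set M := ⨆ i, |w i| with hMdef
  have hle : ∀ i, |w i| ≤ M := le_ciSup (f := fun i => |w i|) (Set.finite_range _).bddAbove
  obtain ⟨i, hi, huniq⟩ := hu
  obtain ⟨l, hl, h⟩ := hasTail_sum_of_eq_one hχ hX hindep (fun i => (M * χ)⁻¹ * w i)
    (s := Finset.univ.erase i) (Finset.notMem_erase i _)
    (by rw [abs_inv_mul_mul_eq hM hχ, hi, div_self hM.ne'])
    (fun j hj => by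
      rw [abs_inv_mul_mul_eq hM hχ, div_lt_one hM]
      exact lt_of_le_of_ne (hle j) fun e => (Finset.ne_of_mem_erase hj) (huniq j e))
  rw [Finset.insert_erase (Finset.mem_univ i)] at h
  refine ⟨l, hl, HasTail.of_map_inv_mul (mul_pos hM hχ)
    (aemeasurable_sum_mul (fun j => (hX j).1) w _) ?_⟩
  simpa only [mul_assoc, ← Finset.mul_sum] using h

end NaturalScale

theorem theorem2 {Ω : Type*} [MeasurableSpace Ω] (μ : Measure Ω) [IsProbabilityMeasure μ]
    (N : ℕ) (c χ : ℝ) (hc : 0 < c) (hχ : 0 < χ)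
    (X : Fin N → Ω → ℝ) (hX : ∀ i, IsModifiedWeibull (X i) c χ μ) (hindep : iIndepFun X μ)
    (w : Fin N → ℝ) (hw : ∃ i, w i ≠ 0)
    {Ω' : Type*} [MeasurableSpace Ω'] (ν : Measure Ω') [IsProbabilityMeasure ν] (Z : Ω' → ℝ) :
    (1 < c →
      IsModifiedWeibull Z c ((∑ i, |w i| ^ (c / (c - 1))) ^ ((c - 1) / c) * χ) ν →
        UpperTailEquiv (fun ω => ∑ i, w i * X i ω) μ Z ν ∧
        LowerTailEquiv (fun ω => ∑ i, w i * X i ω) μ Z ν ∧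
        UpperTailRatio (fun ω => ∑ i, w i * X i ω) μ Z ν
          ((c / (2 * (c - 1))) ^ (((Nat.card {i // w i ≠ 0} : ℝ) - 1) / 2)) ∧
        LowerTailRatio (fun ω => ∑ i, w i * X i ω) μ Z ν
          ((c / (2 * (c - 1))) ^ (((Nat.card {i // w i ≠ 0} : ℝ) - 1) / 2))) ∧
    ((c < 1 ∨ (c = 1 ∧ ∃! i, |w i| = ⨆ j, |w j|)) →
      IsModifiedWeibull Z c ((⨆ i, |w i|) * χ) ν →
        UpperTailEquiv (fun ω => ∑ i, w i * X i ω) μ Z ν ∧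
        LowerTailEquiv (fun ω => ∑ i, w i * X i ω) μ Z ν ∧
        (c < 1 →
          UpperTailRatio (fun ω => ∑ i, w i * X i ω) μ Z ν
            (Nat.card {i // |w i| = ⨆ j, |w j|}) ∧
          LowerTailRatio (fun ω => ∑ i, w i * X i ω) μ Z ν
            (Nat.card {i // |w i| = ⨆ j, |w j|}))) := by
  have hS : AEMeasurable (fun ω => ∑ i, w i * X i ω) μ :=
    aemeasurable_sum_mul (fun j => (hX j).1) w _
  -- The lower tail of the sum is the upper tail of the sum with weights `-w`.
  have hneg : (fun ω => -∑ i, w i * X i ω) = fun ω => ∑ i, -w i * X i ω := by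
    ext ω
    simp
  have hw' : ∃ i, -w i ≠ 0 := hw.imp fun i hi => neg_ne_zero.2 hi
  refine ⟨fun hc1 hZ => ?_, fun hc1 hZ => ?_⟩
  · obtain ⟨hγ, hup⟩ := hasTail_sum_univ_of_one_lt hc1 hχ hX hindep w hw
    have hlow := (hasTail_sum_univ_of_one_lt hc1 hχ hX hindep (fun i => -w i) hw').2
    simp only [abs_neg, ne_eq, neg_eq_zero] at hlow
    have hlpos : 0 < (c / (2 * (c - 1))) ^ (((Nat.card {i // w i ≠ 0} : ℝ) - 1) / 2) :=
      Real.rpow_pos_of_pos (div_pos hc (by linarith)) _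
    have hU := upperTailRatio_of_hasTail hc hγ hS hup hZ
    have hL := lowerTailRatio_of_hasTail hc hγ hS (by rw [hneg]; exact hlow) hZ
    exact ⟨⟨_, hlpos, hU⟩, ⟨_, hlpos, hL⟩, hU, hL⟩
  · have hγ : 0 < (⨆ i, |w i|) * χ := mul_pos (iSup_abs_pos hw) hχ
    rcases hc1 with hc1 | ⟨rfl, hu⟩
    · have hup := hasTail_sum_univ_of_lt_one hc hc1 hχ hX hindep w hw
      have hlow := hasTail_sum_univ_of_lt_one hc hc1 hχ hX hindep (fun i => -w i) hw'
      simp only [abs_neg] at hlow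
      have hU := upperTailRatio_of_hasTail hc hγ hS hup hZ
      have hL := lowerTailRatio_of_hasTail hc hγ hS (by rw [hneg]; exact hlow) hZ
      have hlpos : (0 : ℝ) < Nat.card {i // |w i| = ⨆ j, |w j|} := by
        have : Nonempty (Fin N) := ⟨hw.choose⟩
        obtain ⟨i, hi⟩ := exists_eq_ciSup_of_finite (f := fun i => |w i|)
        have : Nonempty {i // |w i| = ⨆ j, |w j|} := ⟨⟨i, hi⟩⟩
        exact_mod_cast Nat.card_pos
      exact ⟨⟨_, hlpos, hU⟩, ⟨_, hlpos, hL⟩, fun _ => ⟨hU, hL⟩⟩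
    · obtain ⟨l, hl, hup⟩ := hasTail_sum_univ_of_eq_one hχ hX hindep w hw hu
      obtain ⟨l', hl', hlow⟩ := hasTail_sum_univ_of_eq_one hχ hX hindep (fun i => -w i) hw'
        (by simpa only [abs_neg] using hu)
      simp only [abs_neg] at hlow
      exact ⟨⟨l, hl, upperTailRatio_of_hasTail hc hγ hS hup hZ⟩,
        ⟨l', hl', lowerTailRatio_of_hasTail hc hγ hS (by rw [hneg]; exact hlow) hZ⟩,
        fun h => absurd h (lt_irrefl 1)⟩
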